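/- **Setting.** Let $\mathcal X$ be a measurable space with a $\sigma$-finite reference measure $\nu$ (for instance $\mathcal X\subset\mathbb R^d$ with Lebesgue measure), and let $(x,y)\in\mathcal X\times\{+1,-1\}$ have a joint law $p$ whose $\mathcal X$-marginal $p_{\rm U}$ has a density with respect to $\nu$. Let $\pi_\pm=p(y=\pm1)$, and assume $\pi_+,\pi_->0$ and $\pi_+\ne\pi_-$. For two independent copies $(x,y),(x',y')$ of the labelled example put $\pi_{\rm S}=p(y=y')$ and $\pi_{\rm D}=p(y\neq y')$, let $p_{\rm S}$ and $p_{\rm D}$ be the conditional laws of $(x,x')$ given $y=y'$ and given $y\ne y'$, and let $\widetilde p_{\rm S},\widetilde p_{\rm D}$ be their marginals on $\mathcal X$. Let $\ell:\mathbb R\times\{\pm1\}\to[0,\infty)$ be a loss, $R(f)=\mathbf E_{(x,y)\sim p}[\ell(f(x),y)]$, $$\mathcal L(z,t)=\frac{\pi_+\ell(z,t)-\pi_-\ell(z,-t)}{\pi_+-\pi_-},\qquad \widetilde{\mathcal L}(z)=\frac{\ell(z,+1)-\ell(z,-1)}{\pi_+-\pi_-}.$$ From similar pairs $(x_{{\rm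 S},i},x'_{{\rm S},i})_{i\le n_{\rm S}}$, dissimilar pairs $(x_{{\rm D},i},x'_{{\rm D},i})_{i\le n_{\rm D}}$ and unlabeled points $(x_{{\rm U},i})_{i\le n_{\rm U}}$ ($n_{\rm S},n_{\rm D},n_{\rm U}\ge1$) form the empirical risks $$\widehat R_{\rm SU}(f)=\frac{\pi_{\rm S}}{n_{\rm S}}\sum_i\frac{\widetilde{\mathcal L}(f(x_{{\rm S},i}))+\widetilde{\mathcal L}(f(x'_{{\rm S},i}))}{2}+\frac1{n_{\rm U}}\sum_i\mathcal L(f(x_{{\rm U},i}),-1),$$ $$\widehat R_{\rm DU}(f)=-\frac{\pi_{\rm D}}{n_{\rm D}}\sum_i\frac{\widetilde{\mathcal L}(f(x_{{\rm D},i}))+\widetilde{\mathcal L}(f(x'_{{\rm D},i}))}{2}+\frac1{n_{\rm U}}\sum_i\mathcal L(f(x_{{\rm U},i}),+1),$$ $$\widehat R_{\rm SD}(f)=\frac{\pi_{\rm S}}{n_{\rm S}}\sum_i\frac{\mathcal L(f(x_{{\rm S},i}),+1)+\mathcal L(f(x'_{{\rm S},i}),+1)}{2}+\frac{\pi_{\rm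 D}}{n_{\rm D}}\sum_i\frac{\mathcal L(f(x_{{\rm D},i}),-1)+\mathcal L(f(x'_{{\rm D},i}),-1)}{2}.$$ **Assumptions.** The loss $\ell$ is $\rho$-Lipschitz in its first argument ($0<\rho<\infty$). The model class $\mathcal F$ consists of measurable functions $f:\mathcal X\to\mathbb R$ with $\sup_x|f(x)|\le C_b$, and it has a countable subclass such that every $f\in\mathcal F$ is the pointwise limit of a sequence from it. For every $n\ge1$ and every probability measure $\mu$ with a density with respect to $\nu$, $$\mathbf E_{Z_1,\dots,Z_n\sim\mu}\mathbf E_\sigma\Big[\sup_{f\in\mathcal F}\frac1n\sum_{i=1}^n\sigma_if(Z_i)\Big]\le\frac{C_{\mathcal F}}{\sqrt n},$$ where $Z_1,\dots,Z_n$ are i.i.d. and $\sigma_1,\dots,\sigma_n$ are independent uniform signs. Let $f^*$ be a minimizer of $R$ over $\mathcal F$, and let $\widehat f_{\rm SU},\widehat f_{\rm DU},\widehat f_{\rm SD}$ denote minimizers over $\mathcal F$ of $\widehat R_{\rm SU},\widehat R_{\rm DU},\widehat R_{\rm SD}$. Put $$C_\ell=\sup_{|z|\le C_b,\ t\in\{\pm1\}}\ell(z,t),\qquad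 C_{\mathcal F,\ell,\delta}=\frac1{|\pi_+-\pi_-|}\Big(4\rho C_{\mathcal F}+\sqrt{2C_\ell^2\log\tfrac8\delta}\Big).$$ **Theorem.** Let $\delta>0$. (a) Suppose that the $2n_{\rm S}$ points of the similar pairs are i.i.d. from $\widetilde p_{\rm S}$, the $2n_{\rm D}$ points of the dissimilar pairs are i.i.d. from $\widetilde p_{\rm D}$, the unlabeled points are i.i.d. from $p_{\rm U}$, and the three samples are independent. Then with probability at least $1-\delta$ all of the following hold, for all choices of the minimizers: $$R(\widehat f_{\rm SU})-R(f^*)\le C_{\mathcal F,\ell,\delta}\Big(\frac{2\pi_{\rm S}}{\sqrt{2n_{\rm S}}}+\frac1{\sqrt{n_{\rm U}}}\Big),$$ $$R(\widehat f_{\rm DU})-R(f^*)\le C_{\mathcal F,\ell,\delta}\Big(\frac{2\pi_{\rm D}}{\sqrt{2n_{\rm D}}}+\frac1{\sqrt{n_{\rm U}}}\Big),$$ $$R(\widehat f_{\rm SD})-R(f^*)\le C_{\mathcal F,\ell,\delta}\Big(\frac{\pi_{\rm S}}{\sqrt{2n_{\rm S}}}+\frac{\pi_{\rm D}}{\sqrt{2n_{\rm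 D}}}\Big).$$ (b) Suppose instead only that the similar pairs are i.i.d. from $p_{\rm S}$ and the dissimilar pairs are i.i.d. from $p_{\rm D}$ (so that the two members of a pair may be dependent), with the unlabeled points as before and the three samples independent. Then with probability at least $1-\delta$ the three inequalities of (a) all hold, for all choices of the minimizers, with $\sqrt{2n_{\rm S}}$ replaced by $\sqrt{n_{\rm S}}$ (and $\sqrt{2n_{\rm D}}$ unchanged). -/

import Mathlib

open MeasureTheory ProbabilityTheory

noncomputable section

namespace SDU

/-! Labels are the elements `1` and `-1` of `ℤˣ`; the joint law of an example and its label is a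
probability measure `P` on `X × ℤˣ`. -/

section Distributions

variable {X : Type*} [MeasurableSpace X]

/-- The class prior `p(y = t)`. -/
def classPrior (P : Measure (X × ℤˣ)) (t : ℤˣ) : ℝ := P.real {w | w.2 = t}

/-- The event that two labelled examples have the same label. -/
def sameLabel (X : Type*) : Set ((X × ℤˣ) × (X × ℤˣ)) := {w | w.1.2 = w.2.2}

/-- `π_S = p(y = y')` for two independent labelled examples. -/
def simPrior (P : Measure (X × ℤˣ)) : ℝ := (P.prod P).real (sameLabel X)

/-- `π_D = p(y ≠ y')` for two independent labelled examples. -/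
def dissimPrior (P : Measure (X × ℤˣ)) : ℝ := (P.prod P).real (sameLabel X)ᶜ

/-- The law `p_S(x, x') = p(x, x' | y = y')` of a similar pair. -/
def simPair (P : Measure (X × ℤˣ)) : Measure (X × X) :=
  ((P.prod P)[|sameLabel X]).map (fun w => (w.1.1, w.2.1))

/-- The law `p_D(x, x') = p(x, x' | y ≠ y')` of a dissimilar pair. -/
def dissimPair (P : Measure (X × ℤˣ)) : Measure (X × X) :=
  ((P.prod P)[|(sameLabel X)ᶜ]).map (fun w => (w.1.1, w.2.1))

/-- The pointwise law of similar data: the marginal of `p_S`. -/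
def simPoint (P : Measure (X × ℤˣ)) : Measure X := (simPair P).map Prod.fst

/-- The pointwise law of dissimilar data: the marginal of `p_D`. -/
def dissimPoint (P : Measure (X × ℤˣ)) : Measure X := (dissimPair P).map Prod.fst

/-- The law `p_U` of an unlabelled example: the marginal of the joint law. -/
def unlabeled (P : Measure (X × ℤˣ)) : Measure X := P.map Prod.fst

/-- Training data: `nS` similar pairs, `nD` dissimilar pairs, `nU` unlabelled points. -/
abbrev Sample (X : Type*) (nS nD nU : ℕ) : Type _ :=
  (Fin nS → X × X) × (Fin nD → X × X) × (Fin nU → X)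

/-- The law of training data that consist of independent similar pairs with law `qS`, independent
dissimilar pairs with law `qD`, and independent unlabelled points with law `qU`. -/
def sampleLaw (qS qD : Measure (X × X)) (qU : Measure X) (nS nD nU : ℕ) :
    Measure (Sample X nS nD nU) :=
  (Measure.pi fun _ : Fin nS => qS).prod
    ((Measure.pi fun _ : Fin nD => qD).prod (Measure.pi fun _ : Fin nU => qU))

/-- Pointwise generation process: the `2 nS` points of the similar pairs are i.i.d. with the
pointwise law of similar data, and likewise the `2 nD` points of the dissimilar pairs. -/
def pointwiseLaw (P : Measure (X × ℤˣ)) (nS nD nU : ℕ) : Measure (Sample X nS nD nU) :=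
  sampleLaw ((simPoint P).prod (simPoint P)) ((dissimPoint P).prod (dissimPoint P))
    (unlabeled P) nS nD nU

/-- Pairwise generation process: the similar pairs are i.i.d. with law `p_S`, the dissimilar pairs
are i.i.d. with law `p_D`; the two members of a pair are in general dependent. -/
def pairwiseLaw (P : Measure (X × ℤˣ)) (nS nD nU : ℕ) : Measure (Sample X nS nD nU) :=
  sampleLaw (simPair P) (dissimPair P) (unlabeled P) nS nD nU

end Distributions

section Risks

variable {X : Type*} [MeasurableSpace X]

/-- The classification risk `R(f) = E[ℓ(f(X), Y)]`. -/
def risk (P : Measure (X × ℤˣ)) (ℓ : ℝ → ℤˣ → ℝ) (f : X → ℝ) : ℝ :=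
  ∫ w, ℓ (f w.1) w.2 ∂P

/-- `L(z, t) = (π₊ ℓ(z, t) - π₋ ℓ(z, -t)) / (π₊ - π₋)`. -/
def corrLoss (P : Measure (X × ℤˣ)) (ℓ : ℝ → ℤˣ → ℝ) (z : ℝ) (t : ℤˣ) : ℝ :=
  classPrior P 1 / (classPrior P 1 - classPrior P (-1)) * ℓ z t
    - classPrior P (-1) / (classPrior P 1 - classPrior P (-1)) * ℓ z (-t)

/-- `L̃(z) = (ℓ(z, +1) - ℓ(z, -1)) / (π₊ - π₋)`. -/
def diffLoss (P : Measure (X × ℤˣ)) (ℓ : ℝ → ℤˣ → ℝ) (z : ℝ) : ℝ :=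
  1 / (classPrior P 1 - classPrior P (-1)) * ℓ z 1
    - 1 / (classPrior P 1 - classPrior P (-1)) * ℓ z (-1)

/-- The average of `g` over all members of `n` pairs. -/
def pairMean {n : ℕ} (s : Fin n → X × X) (g : X → ℝ) : ℝ :=
  (1 / (n : ℝ)) * ∑ i, (g (s i).1 + g (s i).2) / 2

/-- The average of `g` over `n` points. -/
def pointMean {n : ℕ} (u : Fin n → X) (g : X → ℝ) : ℝ :=
  (1 / (n : ℝ)) * ∑ i, g (u i)

variable {nS nD nU : ℕ}

/-- The empirical SU risk. -/
def empRiskSU (P : Measure (X × ℤˣ)) (ℓ : ℝ → ℤˣ → ℝ) (D : Sample X nS nD nU) (f : X → ℝ) : ℝ :=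
  simPrior P * pairMean D.1 (fun x => diffLoss P ℓ (f x))
    + pointMean D.2.2 (fun x => corrLoss P ℓ (f x) (-1))

/-- The empirical DU risk. -/
def empRiskDU (P : Measure (X × ℤˣ)) (ℓ : ℝ → ℤˣ → ℝ) (D : Sample X nS nD nU) (f : X → ℝ) : ℝ :=
  dissimPrior P * pairMean D.2.1 (fun x => -diffLoss P ℓ (f x))
    + pointMean D.2.2 (fun x => corrLoss P ℓ (f x) 1)

/-- The empirical SD risk. -/
def empRiskSD (P : Measure (X × ℤˣ)) (ℓ : ℝ → ℤˣ → ℝ) (D : Sample X nS nD nU) (f : X → ℝ) : ℝ :=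
  simPrior P * pairMean D.1 (fun x => corrLoss P ℓ (f x) 1)
    + dissimPrior P * pairMean D.2.1 (fun x => corrLoss P ℓ (f x) (-1))

end Risks

/-- `f` is a minimizer over the class `F` of the functional `J`. -/
def IsMinimizer {X : Type*} (F : Set (X → ℝ)) (J : (X → ℝ) → ℝ) (f : X → ℝ) : Prop :=
  f ∈ F ∧ ∀ g ∈ F, J f ≤ J g

/-- The expected Rademacher complexity of the class `H` for samples of size `n` from `μ`. -/
def rademacher {X : Type*} [MeasurableSpace X] (H : Set (X → ℝ)) (n : ℕ) (μ : Measure X) : ℝ :=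
  ∫ z : Fin n → X,
    (1 / (2 : ℝ) ^ n) * ∑ σ : Fin n → ℤˣ,
      ⨆ h : H, (1 / (n : ℝ)) * ∑ i, (((σ i : ℤˣ) : ℤ) : ℝ) * (h : X → ℝ) (z i)
  ∂(Measure.pi fun _ : Fin n => μ)

/-- The usual measurability condition on a function class: its members are measurable, and every
member is the pointwise limit of a sequence from one fixed countable subclass. -/
def IsPointwiseMeasurable {X : Type*} [MeasurableSpace X] (F : Set (X → ℝ)) : Prop :=
  (∀ f ∈ F, Measurable f) ∧
    ∃ F₀ ⊆ F, F₀.Countable ∧ ∀ f ∈ F, ∃ u : ℕ → X → ℝ, (∀ k, u k ∈ F₀) ∧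
      ∀ x, Filter.Tendsto (fun k => u k x) Filter.atTop (nhds (f x))

/-- The largest loss on predictions in `[-b, b]`. -/
def maxLoss (ℓ : ℝ → ℤˣ → ℝ) (b : ℝ) : ℝ :=
  sSup {c | ∃ (z : ℝ) (t : ℤˣ), |z| ≤ b ∧ c = ℓ z t}

/-- The constant `(4 ρ C_F + √(2 C_ℓ² log (8 / δ))) / |π₊ - π₋|`. -/
def boundConst {X : Type*} [MeasurableSpace X] (P : Measure (X × ℤˣ)) (ρ CF Cl δ : ℝ) : ℝ :=
  1 / |classPrior P 1 - classPrior P (-1)| *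
    (4 * ρ * CF + √(2 * Cl ^ 2 * Real.log (8 / δ)))

/-- The property `A` holds with `Q`-probability at least `1 - δ`. -/
def WithProbAtLeast {Ω : Type*} [MeasurableSpace Ω] (Q : Measure Ω) (δ : ℝ) (A : Ω → Prop) :
    Prop :=
  ∃ E : Set Ω, MeasurableSet E ∧ 1 - δ ≤ Q.real E ∧ ∀ ω ∈ E, A ω

end SDU

end

/-! Write `μ₊`, `μ₋` for the parts of the marginal law carried by the two classes (`classPart`), of
masses `π₊`, `π₋`. Then `π_S p̃_S = π₊μ₊ + π₋μ₋`, `π_D p̃_D = π₋μ₊ + π₊μ₋` and `p_U = μ₊ + μ₋`.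
Since `π₊ ≠ π₋`, any two of these recover `μ₊` and `μ₋`, and the corrected losses carry out the
inversion: `risk_eq_SU`, `risk_eq_DU` and `risk_eq_SD` say that the three empirical risks have
expectation `R`.

Call expectation minus sample mean the shortfall. As the empirical risk of a minimizer is at most
that of `f*`, its excess risk is at most the weighted sum, over the two samples used, of its
shortfall minus that of `f*`. So a one-sided bound for the supremum of these differences suffices
(`exists_shortfall_event`). Its expectation is at most `2L` times the Rademacher complexity, by
symmetrization and contraction done together one coordinate at a time
(`integral_iSup_sum_midValue_le`); its fluctuation is controlled by a tensorized Hoeffding lemma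
(`LipSubgaussian`) and Chernoff's bound. Measurability is handled on the countable subclass, and
pointwise limits give the rest of `F`.

The number of effective points is set by a variance proxy `K` per pair, through `4 K N = n`. An
arbitrary pair counts as one observation: `K = 1/4`, `N = n`. A pair with independent members has `K
= 1/8`, so `N = 2n`. Dissimilar pairs also reach `N = 2n`, although their members are dependent:
`p_D` is the equal mixture of a product law and its swap, and the average over a pair does not see
the order. The pseudo-distance `pairDist`, which identifies a pair with its swap, expresses this
(`lipSubgaussian_dissimPair`). A similar pair is a mixture of two different products, and the
argument treats it as a single observation. -/

noncomputable section

namespace SDU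

/-! ### Bounded measurable functions -/

section BoundedMeasurable

variable {Y Z : Type*} [MeasurableSpace Y] [MeasurableSpace Z]

/-- `g` is measurable and bounded. -/
def BddMeas (g : Y → ℝ) : Prop := Measurable g ∧ ∃ B, ∀ y, |g y| ≤ B

lemma BddMeas.integrable {g : Y → ℝ} (hg : BddMeas g) (q : Measure Y) [IsFiniteMeasure q] :
    Integrable g q := by
  obtain ⟨hm, B, hB⟩ := hg
  exact Integrable.of_bound hm.aestronglyMeasurable B (ae_of_all _ hB)

lemma BddMeas.const (c : ℝ) : BddMeas (fun _ : Y => c) :=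
  ⟨measurable_const, |c|, fun _ => le_rfl⟩

lemma BddMeas.add {g h : Y → ℝ} (hg : BddMeas g) (hh : BddMeas h) :
    BddMeas (fun y => g y + h y) := by
  obtain ⟨hm, B, hB⟩ := hg
  obtain ⟨hm', B', hB'⟩ := hh
  exact ⟨hm.add hm', B + B', fun y => (abs_add_le _ _).trans (add_le_add (hB y) (hB' y))⟩

lemma BddMeas.const_mul {g : Y → ℝ} (hg : BddMeas g) (c : ℝ) : BddMeas (fun y => c * g y) := by
  obtain ⟨hm, B, hB⟩ := hg
  exact ⟨hm.const_mul c, |c| * B, fun y => by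
    rw [abs_mul]; exact mul_le_mul_of_nonneg_left (hB y) (abs_nonneg c)⟩

lemma BddMeas.neg {g : Y → ℝ} (hg : BddMeas g) : BddMeas (fun y => -g y) := by
  simpa using hg.const_mul (-1)

lemma BddMeas.sub {g h : Y → ℝ} (hg : BddMeas g) (hh : BddMeas h) :
    BddMeas (fun y => g y - h y) := by
  simpa [sub_eq_add_neg] using hg.add hh.neg

lemma BddMeas.sum {κ : Type*} (s : Finset κ) {g : κ → Y → ℝ} (hg : ∀ k, BddMeas (g k)) :
    BddMeas (fun y => ∑ k ∈ s, g k y) := by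
  classical
  induction s using Finset.induction_on with
  | empty => simpa using BddMeas.const 0
  | insert a s ha ih => simpa [Finset.sum_insert ha] using (hg a).add ih

lemma BddMeas.comp {g : Y → ℝ} (hg : BddMeas g) {e : Z → Y} (he : Measurable e) :
    BddMeas (fun z => g (e z)) := by
  obtain ⟨hm, B, hB⟩ := hg
  exact ⟨hm.comp he, B, fun z => hB (e z)⟩

lemma BddMeas.exp {g : Y → ℝ} (hg : BddMeas g) : BddMeas (fun y => Real.exp (g y)) := by
  obtain ⟨hm, B, hB⟩ := hg
  refine ⟨hm.exp, Real.exp B, fun y => ?_⟩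
  rw [Real.abs_exp]
  exact Real.exp_le_exp.2 ((le_abs_self _).trans (hB y))

lemma bddAbove_range_of_abs_le {ι : Type*} {g : ι → ℝ} {B : ℝ} (h : ∀ i, |g i| ≤ B) :
    BddAbove (Set.range g) :=
  ⟨B, by rintro _ ⟨i, rfl⟩; exact (le_abs_self _).trans (h i)⟩

lemma abs_iSup_le {ι : Type*} [Nonempty ι] {g : ι → ℝ} {B : ℝ} (h : ∀ i, |g i| ≤ B) :
    |⨆ i, g i| ≤ B := by
  obtain ⟨i⟩ := id ‹Nonempty ι›
  exact abs_le.2 ⟨(abs_le.1 (h i)).1.trans (le_ciSup (bddAbove_range_of_abs_le h) i),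
    ciSup_le fun j => (le_abs_self _).trans (h j)⟩

lemma BddMeas.iSup {ι : Type*} [Countable ι] [Nonempty ι] {g : ι → Y → ℝ}
    (hm : ∀ i, Measurable (g i)) {B : ℝ} (hB : ∀ i y, |g i y| ≤ B) :
    BddMeas (fun y => ⨆ i, g i y) :=
  ⟨Measurable.iSup hm, B, fun y => abs_iSup_le fun i => hB i y⟩

lemma BddMeas.integral_right {g : Y × Z → ℝ} (hg : BddMeas g) (q : Measure Z)
    [IsProbabilityMeasure q] : BddMeas (fun y => ∫ z, g (y, z) ∂q) := by
  obtain ⟨hm, B, hB⟩ := hg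
  refine ⟨(hm.stronglyMeasurable.integral_prod_right' (ν := q)).measurable, B, fun y => ?_⟩
  simpa using norm_integral_le_of_norm_le_const (μ := q) (f := fun z => g (y, z))
    (ae_of_all _ fun z => hB (y, z))

lemma BddMeas.integral_left {g : Y × Z → ℝ} (hg : BddMeas g) (q : Measure Y)
    [IsProbabilityMeasure q] : BddMeas (fun z => ∫ y, g (y, z) ∂q) :=
  (hg.comp measurable_swap).integral_right q

lemma BddMeas.integral_prod {g : Y × Z → ℝ} (hg : BddMeas g) (q : Measure Y) (r : Measure Z)
    [IsProbabilityMeasure q] [IsProbabilityMeasure r] :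
    ∫ w, g w ∂(q.prod r) = ∫ y, ∫ z, g (y, z) ∂r ∂q :=
  MeasureTheory.integral_prod g (hg.integrable _)

lemma BddMeas.integral_prod_symm {g : Y × Z → ℝ} (hg : BddMeas g) (q : Measure Y) (r : Measure Z)
    [IsProbabilityMeasure q] [IsProbabilityMeasure r] :
    ∫ w, g w ∂(q.prod r) = ∫ z, ∫ y, g (y, z) ∂q ∂r :=
  MeasureTheory.integral_prod_symm g (hg.integrable _)

lemma BddMeas.integral_mono {g h : Y → ℝ} (hg : BddMeas g) (hh : BddMeas h) (q : Measure Y)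
    [IsFiniteMeasure q] (hle : ∀ y, g y ≤ h y) : ∫ y, g y ∂q ≤ ∫ y, h y ∂q :=
  MeasureTheory.integral_mono (hg.integrable q) (hh.integrable q) hle

lemma measurable_finCons {n : ℕ} :
    Measurable (fun w : Y × (Fin n → Y) => (Fin.cons w.1 w.2 : Fin (n + 1) → Y)) := by
  refine measurable_pi_lambda _ fun i => ?_
  refine Fin.cases ?_ (fun j => ?_) i
  · simpa using measurable_fst
  · simpa [Function.comp_def] using (measurable_pi_apply j).comp
      (measurable_snd (α := Y) (β := Fin n → Y))

lemma integral_pi_succ {n : ℕ} (q : Measure Y) [IsProbabilityMeasure q]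
    (g : (Fin (n + 1) → Y) → ℝ) :
    ∫ z, g z ∂(Measure.pi fun _ : Fin (n + 1) => q) =
      ∫ w : Y × (Fin n → Y), g (Fin.cons w.1 w.2) ∂(q.prod (Measure.pi fun _ : Fin n => q)) := by
  have h := measurePreserving_piFinSuccAbove (fun _ : Fin (n + 1) => q) 0
  rw [← h.symm.integral_comp']
  simp [MeasurableEquiv.piFinSuccAbove, Fin.insertNthEquiv, Fin.insertNth_zero']

end BoundedMeasurable

/-! ### Sub-Gaussian concentration of Lipschitz functions -/

section DiscreteDist

variable {Y : Type*}

open Classical in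
/-- The discrete distance. -/
def discreteDist (y y' : Y) : ℝ := if y = y' then 0 else 1

lemma discreteDist_self (y : Y) : discreteDist y y = 0 := by simp [discreteDist]

lemma discreteDist_nonneg (y y' : Y) : 0 ≤ discreteDist y y' := by
  unfold discreteDist; split_ifs <;> norm_num

lemma discreteDist_le_one (y y' : Y) : discreteDist y y' ≤ 1 := by
  unfold discreteDist; split_ifs <;> norm_num

lemma le_mul_discreteDist {v : Y → ℝ} {c : ℝ} (h : ∀ y y', v y - v y' ≤ c) (y y' : Y) :
    v y - v y' ≤ c * discreteDist y y' := by
  unfold discreteDist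
  split_ifs with he
  · simp [he]
  · simpa using h y y'

end DiscreteDist

section Concentration

variable {Y Z : Type*} [MeasurableSpace Y] [MeasurableSpace Z]

/-- Under `q`, bounded measurable functions whose increments are dominated by `c * D` have the
moment generating function of a sub-Gaussian variable with variance proxy `c ^ 2 * K`. -/
def LipSubgaussian (q : Measure Y) (D : Y → Y → ℝ) (K : ℝ) : Prop :=
  ∀ g : Y → ℝ, BddMeas g → ∀ c : ℝ, 0 ≤ c → (∀ y y', g y - g y' ≤ c * D y y') →
    ∫ y, Real.exp (g y) ∂q ≤ Real.exp (∫ y, g y ∂q + c ^ 2 * K / 2)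

/-- Hoeffding's lemma: domination by `c` times the discrete distance confines the function to an
interval of length `c`, so its variance proxy is `(c / 2) ^ 2`. -/
lemma lipSubgaussian_discreteDist (q : Measure Y) [IsProbabilityMeasure q] :
    LipSubgaussian q discreteDist (1 / 4) := by
  intro g hg c hc hD
  obtain ⟨hm, B, hB⟩ := hg
  have : Nonempty Y := q.nonempty_of_neZero
  have hosc : ∀ y y', g y - g y' ≤ c := fun y y' =>
    (hD y y').trans (mul_le_of_le_one_right hc (discreteDist_le_one y y'))
  have hbdd : BddBelow (Set.range g) :=
    ⟨-B, by rintro _ ⟨y, rfl⟩; exact (abs_le.1 (hB y)).1⟩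
  have hmem : ∀ y, g y ∈ Set.Icc (⨅ y, g y) ((⨅ y, g y) + c) := fun y =>
    ⟨ciInf_le hbdd y, by
      have : g y - c ≤ ⨅ y, g y := le_ciInf fun y' => by linarith [hosc y y']
      linarith⟩
  have h := (hasSubgaussianMGF_of_mem_Icc (μ := q) hm.aemeasurable (ae_of_all _ hmem)).mgf_le 1
  simp only [mgf, one_mul, add_sub_cancel_left, Real.exp_sub, integral_div] at h
  rw [div_le_iff₀ (Real.exp_pos _), ← Real.exp_add] at h
  refine h.trans (Real.exp_le_exp.2 (le_of_eq ?_))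
  push_cast
  rw [Real.norm_of_nonneg hc]
  ring

/-- Freeze the first coordinate and integrate out the second: this costs `c ^ 2 * K' / 2`. The
conditional mean is again dominated by `c * D`, because the other distance vanishes on the diagonal,
so the first factor adds `c ^ 2 * K / 2`. -/
lemma LipSubgaussian.prod {q : Measure Y} {r : Measure Z} [IsProbabilityMeasure q]
    [IsProbabilityMeasure r] {D : Y → Y → ℝ} {D' : Z → Z → ℝ} {K K' : ℝ}
    (hq : LipSubgaussian q D K) (hr : LipSubgaussian r D' K')
    (hD : ∀ y, D y y = 0) (hD' : ∀ z, D' z z = 0) :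
    LipSubgaussian (q.prod r) (fun w w' => D w.1 w'.1 + D' w.2 w'.2) (K + K') := by
  intro g hg c hc hL
  have hsec : ∀ y, BddMeas (fun z => g (y, z)) := fun y => hg.comp measurable_prodMk_left
  have hmean := hg.integral_right r
  rw [hg.exp.integral_prod, hg.integral_prod]
  calc ∫ y, ∫ z, Real.exp (g (y, z)) ∂r ∂q
      ≤ ∫ y, Real.exp (c ^ 2 * K' / 2) * Real.exp (∫ z, g (y, z) ∂r) ∂q := by
        refine BddMeas.integral_mono (hg.exp.integral_right r) (hmean.exp.const_mul _) q fun y => ?_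
        rw [← Real.exp_add, add_comm]
        refine hr _ (hsec y) c hc fun z z' => ?_
        simpa [hD] using hL (y, z) (y, z')
    _ = Real.exp (c ^ 2 * K' / 2) * ∫ y, Real.exp (∫ z, g (y, z) ∂r) ∂q := integral_const_mul _ _
    _ ≤ Real.exp (c ^ 2 * K' / 2) *
          Real.exp (∫ y, ∫ z, g (y, z) ∂r ∂q + c ^ 2 * K / 2) := by
        refine mul_le_mul_of_nonneg_left (hq _ hmean c hc fun y y' => ?_) (Real.exp_pos _).le
        rw [← integral_sub ((hsec y).integrable r) ((hsec y').integrable r)]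
        refine (BddMeas.integral_mono ((hsec y).sub (hsec y')) (BddMeas.const (c * D y y')) r
          fun z => ?_).trans (by simp)
        simpa [hD'] using hL (y, z) (y', z)
    _ = _ := by rw [← Real.exp_add]; ring_nf

lemma LipSubgaussian.pi {q : Measure Y} [IsProbabilityMeasure q] {D : Y → Y → ℝ} {K : ℝ}
    (hq : LipSubgaussian q D K) (hD : ∀ y, D y y = 0) (n : ℕ) :
    LipSubgaussian (Measure.pi fun _ : Fin n => q) (fun z z' => ∑ k, D (z k) (z' k)) (n * K) := by
  induction n with
  | zero =>
    intro g _ c _ _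
    rw [Measure.pi_of_empty, integral_dirac, integral_dirac]
    simp
  | succ n ih =>
    intro g hg c hc hL
    rw [integral_pi_succ, integral_pi_succ]
    have h := (hq.prod ih hD (fun z => by simp [hD])) _ (hg.comp measurable_finCons) c hc
      (fun w w' => by simpa [Fin.sum_univ_succ] using hL (Fin.cons w.1 w.2) (Fin.cons w'.1 w'.2))
    refine h.trans (le_of_eq ?_)
    push_cast
    ring_nf

/-- Chernoff's bound for functions with dominated increments. -/
lemma LipSubgaussian.measureReal_ge_le {q : Measure Y} [IsProbabilityMeasure q] {D : Y → Y → ℝ}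
    {K : ℝ} (hq : LipSubgaussian q D K) (hK : 0 < K) {g : Y → ℝ} (hg : BddMeas g) {c : ℝ}
    (hc : 0 < c) (hL : ∀ y y', g y - g y' ≤ c * D y y') {s : ℝ} (hs : 0 ≤ s) :
    q.real {y | ∫ y, g y ∂q + c * √(2 * K * s) ≤ g y} ≤ Real.exp (-s) := by
  -- This `t` minimizes the Chernoff exponent `t² c² K / 2 - t c √(2 K s)`; there the two terms
  -- equal `s` and `2 s`.
  set t : ℝ := √(2 * K * s) / (c * K) with ht
  have ht0 : 0 ≤ t := by positivity
  have h1 := hq _ (hg.const_mul t) (t * c) (by positivity) (fun y y' => by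
    rw [← mul_sub, mul_assoc]; exact mul_le_mul_of_nonneg_left (hL y y') ht0)
  rw [integral_const_mul] at h1
  set m := ∫ y, g y ∂q
  have h2 := mul_meas_ge_le_integral_of_nonneg (μ := q)
    (f := fun y => Real.exp (t * g y)) (ae_of_all _ fun y => (Real.exp_pos _).le)
    ((hg.const_mul t).exp.integrable q) (Real.exp (t * (m + c * √(2 * K * s))))
  have hsub : {y | m + c * √(2 * K * s) ≤ g y} ⊆
      {y | Real.exp (t * (m + c * √(2 * K * s))) ≤ Real.exp (t * g y)} := fun y hy =>
    Real.exp_le_exp.2 (mul_le_mul_of_nonneg_left hy ht0)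
  have h3 := (mul_le_mul_of_nonneg_left (measureReal_mono (μ := q) hsub)
    (Real.exp_pos (t * (m + c * √(2 * K * s)))).le).trans (h2.trans h1)
  rw [← le_div_iff₀' (Real.exp_pos _), ← Real.exp_sub] at h3
  refine h3.trans (Real.exp_le_exp.2 (le_of_eq ?_))
  have hsq : √(2 * K * s) ^ 2 = 2 * K * s := Real.sq_sqrt (by positivity)
  have e1 : t * (c * √(2 * K * s)) = 2 * s := by
    rw [ht]; field_simp; rw [hsq]
  have e2 : (t * c) ^ 2 * K / 2 = s := by
    rw [ht]; field_simp; rw [hsq]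
  rw [mul_add, e1, e2]
  ring

end Concentration

/-! ### Uniformly bounded families of measurable functions -/

section Families

variable {ι Y Z : Type*} [MeasurableSpace Y] [MeasurableSpace Z]

/-- The members of the family `g` are measurable and uniformly bounded. -/
def UnifBddMeas (g : ι → Y → ℝ) : Prop := (∀ i, Measurable (g i)) ∧ ∃ B, ∀ i y, |g i y| ≤ B

lemma UnifBddMeas.bddMeas {g : ι → Y → ℝ} (hg : UnifBddMeas g) (i : ι) : BddMeas (g i) :=
  ⟨hg.1 i, hg.2.imp fun _ h => h i⟩

lemma UnifBddMeas.const {a : ι → ℝ} (ha : ∃ A, ∀ i, |a i| ≤ A) :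
    UnifBddMeas (fun i (_ : Y) => a i) :=
  ⟨fun _ => measurable_const, ha.imp fun _ h i _ => h i⟩

lemma UnifBddMeas.add {g h : ι → Y → ℝ} (hg : UnifBddMeas g) (hh : UnifBddMeas h) :
    UnifBddMeas (fun i y => g i y + h i y) := by
  obtain ⟨hm, B, hB⟩ := hg
  obtain ⟨hm', B', hB'⟩ := hh
  exact ⟨fun i => (hm i).add (hm' i), B + B',
    fun i y => (abs_add_le _ _).trans (add_le_add (hB i y) (hB' i y))⟩

lemma UnifBddMeas.const_mul {g : ι → Y → ℝ} (hg : UnifBddMeas g) (c : ℝ) :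
    UnifBddMeas (fun i y => c * g i y) := by
  obtain ⟨hm, B, hB⟩ := hg
  exact ⟨fun i => (hm i).const_mul c, |c| * B, fun i y => by
    rw [abs_mul]; exact mul_le_mul_of_nonneg_left (hB i y) (abs_nonneg c)⟩

lemma UnifBddMeas.sub {g h : ι → Y → ℝ} (hg : UnifBddMeas g) (hh : UnifBddMeas h) :
    UnifBddMeas (fun i y => g i y - h i y) := by
  simpa [sub_eq_add_neg] using hg.add (hh.const_mul (-1))

lemma UnifBddMeas.comp {g : ι → Y → ℝ} (hg : UnifBddMeas g) {e : Z → Y} (he : Measurable e) :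
    UnifBddMeas (fun i z => g i (e z)) := by
  obtain ⟨hm, B, hB⟩ := hg
  exact ⟨fun i => (hm i).comp he, B, fun i z => hB i (e z)⟩

lemma UnifBddMeas.sum {κ : Type*} (s : Finset κ) {g : κ → ι → Y → ℝ}
    (hg : ∀ k, UnifBddMeas (g k)) : UnifBddMeas (fun i y => ∑ k ∈ s, g k i y) := by
  classical
  induction s using Finset.induction_on with
  | empty => simpa using UnifBddMeas.const (ι := ι) (Y := Y) (a := 0) ⟨0, by simp⟩
  | insert a s ha ih => simpa [Finset.sum_insert ha] using (hg a).add ih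

lemma UnifBddMeas.exists_abs_le {g : ι → Y → ℝ} (hg : UnifBddMeas g) (y : Y) :
    ∃ A, ∀ i, |g i y| ≤ A := hg.2.imp fun _ h i => h i y

lemma UnifBddMeas.bddAbove {g : ι → Y → ℝ} (hg : UnifBddMeas g) (y : Y) :
    BddAbove (Set.range fun i => g i y) :=
  bddAbove_range_of_abs_le (hg.exists_abs_le y).choose_spec

lemma UnifBddMeas.iSup [Countable ι] [Nonempty ι] {g : ι → Y → ℝ} (hg : UnifBddMeas g) :
    BddMeas (fun y => ⨆ i, g i y) :=
  BddMeas.iSup hg.1 hg.2.choose_spec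

lemma UnifBddMeas.exists_abs_integral_le {g : ι → Y → ℝ} (hg : UnifBddMeas g) (q : Measure Y)
    [IsProbabilityMeasure q] : ∃ A, ∀ i, |∫ y, g i y ∂q| ≤ A :=
  hg.2.imp fun B hB i => by
    simpa using norm_integral_le_of_norm_le_const (μ := q) (f := g i) (ae_of_all _ fun y => hB i y)

end Families

/-! ### Symmetrization and contraction -/

section Symmetrization

variable {ι X Y : Type*} [MeasurableSpace X] [MeasurableSpace Y]

/-- The average over all signs of the supremum of `a i + ∑ c σₖ f i (z k)`. -/
def signedSup {n : ℕ} (a : ι → ℝ) (f : ι → X → ℝ) (c : ℝ) (z : Fin n → X) : ℝ :=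
  (1 / (2 : ℝ) ^ n) * ∑ σ : Fin n → ℤˣ,
    ⨆ i, (a i + ∑ k, c * (((σ k : ℤˣ) : ℤ) : ℝ) * f i (z k))

omit [MeasurableSpace X] in
-- Conditioning on the first sign moves its term into the offset `a`; this is the recursion that
-- drives the coordinatewise induction.
lemma signedSup_cons {n : ℕ} (a : ι → ℝ) (f : ι → X → ℝ) (c : ℝ) (x : X) (z : Fin n → X) :
    signedSup a f c (Fin.cons x z : Fin (n + 1) → X) =
      (1 / 2) * (signedSup (fun i => a i + c * f i x) f c z
        + signedSup (fun i => a i - c * f i x) f c z) := by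
  unfold signedSup
  rw [← (Fin.consEquiv fun _ : Fin (n + 1) => ℤˣ).sum_comp, Fintype.sum_prod_type]
  have hu : (Finset.univ : Finset ℤˣ) = {1, -1} := rfl
  rw [hu, Finset.sum_pair (by decide)]
  simp only [Fin.consEquiv_apply, Fin.sum_univ_succ, Fin.cons_zero, Fin.cons_succ]
  simp only [Units.val_one, Int.cast_one, mul_one, Units.val_neg, Int.cast_neg, mul_neg, neg_mul,
    ← add_assoc, ← sub_eq_add_neg, pow_succ]
  ring

lemma UnifBddMeas.signedSup [Countable ι] [Nonempty ι] {a : ι → ℝ} (ha : ∃ A, ∀ i, |a i| ≤ A)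
    {f : ι → X → ℝ} (hf : UnifBddMeas f) (c : ℝ) (n : ℕ) :
    BddMeas (fun z : Fin n → X => signedSup a f c z) := by
  unfold SDU.signedSup
  refine BddMeas.const_mul (BddMeas.sum _ fun σ => UnifBddMeas.iSup ?_) _
  exact (UnifBddMeas.const ha).add
    (UnifBddMeas.sum _ fun k => (hf.comp (measurable_pi_apply k)).const_mul _)

omit [MeasurableSpace X] in
-- Talagrand's contraction for one sign, combined with the splitting of `u - v`. Only increments of
-- `u` and `v` are compared, so no normalization at zero is needed; the sign of `s i - s j` decides
-- which index goes into the supremum with `+`.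
lemma iSup_add_iSup_contraction [Nonempty ι] {a s t u v : ι → ℝ} {L : ℝ}
    (ha : ∃ A, ∀ i, |a i| ≤ A) (hs : ∃ A, ∀ i, |s i| ≤ A) (ht : ∃ A, ∀ i, |t i| ≤ A)
    (hu : ∀ i j, |u i - u j| ≤ L * |s i - s j|) (hv : ∀ i j, |v i - v j| ≤ L * |t i - t j|) :
    (⨆ i, (a i + (u i - v i))) + (⨆ i, (a i + (v i - u i))) ≤
      (1 / 2) * ((⨆ i, (a i + 2 * L * s i)) + (⨆ i, (a i - 2 * L * s i)))
        + (1 / 2) * ((⨆ i, (a i + 2 * L * t i)) + (⨆ i, (a i - 2 * L * t i))) := by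
  obtain ⟨A, hA⟩ := ha
  have key : ∀ {s u : ι → ℝ}, (∃ A, ∀ i, |s i| ≤ A) → (∀ i j, |u i - u j| ≤ L * |s i - s j|) →
      ∀ i j, a i + a j + 2 * (u i - u j) ≤
        (⨆ i, (a i + 2 * L * s i)) + (⨆ i, (a i - 2 * L * s i)) := by
    intro s u ⟨B, hB⟩ hu i j
    have hb : ∀ c : ℝ, ∀ i, |a i + c * s i| ≤ A + |c| * B := fun c i =>
      (abs_add_le _ _).trans (add_le_add (hA i) (by
        rw [abs_mul]; exact mul_le_mul_of_nonneg_left (hB i) (abs_nonneg c)))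
    have h1 : ∀ i, a i + 2 * L * s i ≤ ⨆ i, (a i + 2 * L * s i) := fun i =>
      le_ciSup (f := fun i => a i + 2 * L * s i) (bddAbove_range_of_abs_le (hb _)) i
    have h2 : ∀ i, a i - 2 * L * s i ≤ ⨆ i, (a i - 2 * L * s i) := fun i =>
      le_ciSup (f := fun i => a i - 2 * L * s i)
        (bddAbove_range_of_abs_le fun i => by simpa [sub_eq_add_neg] using hb (-(2 * L)) i) i
    have h := (le_abs_self _).trans (hu i j)
    rcases abs_cases (s i - s j) with ⟨he, -⟩ | ⟨he, -⟩ <;> rw [he] at h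
    · linarith [h1 i, h2 j]
    · linarith [h1 j, h2 i]
  -- The two terms add up to half of `a i + a j + 2 (u i - u j)` plus half of `a i + a j + 2 (v j -
  -- v i)`; hence `key` is used at `(i, j)` for `u` and at `(j, i)` for `v`.
  refine ciSup_add_ciSup_le fun i j => ?_
  have h1 := key hs hu i j
  have h2 := key ht hv j i
  linarith

lemma BddMeas.integral_prod_mean {g : X → ℝ} (hg : BddMeas g) (μ : Measure X)
    [IsProbabilityMeasure μ] :
    ∫ w : X × X, ((1 / 2) * g w.2 + (1 / 2) * g w.1) ∂(μ.prod μ) = ∫ x, g x ∂μ := by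
  rw [integral_add (((hg.comp measurable_snd).const_mul _).integrable _)
    (((hg.comp measurable_fst).const_mul _).integrable _), integral_const_mul,
    integral_const_mul, (hg.comp measurable_snd).integral_prod,
    (hg.comp measurable_fst).integral_prod]
  simp only [integral_const, probReal_univ, one_smul]
  ring

/-- Symmetrization and contraction in one coordinate. -/
lemma integral_iSup_sub_le [Countable ι] [Nonempty ι] (μ : Measure X) [IsProbabilityMeasure μ]
    {f h : ι → X → ℝ} (hf : UnifBddMeas f) (hh : UnifBddMeas h) {L : ℝ}
    (hL : ∀ i j x, |h i x - h j x| ≤ L * |f i x - f j x|) {a : ι → ℝ} (ha : ∃ A, ∀ i, |a i| ≤ A) :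
    ∫ x, ⨆ i, (a i + (∫ x', h i x' ∂μ - h i x)) ∂μ ≤
      ∫ x, (1 / 2) * ((⨆ i, (a i + 2 * L * f i x)) + (⨆ i, (a i - 2 * L * f i x))) ∂μ := by
  have ha' : ∀ {Z : Type _} [MeasurableSpace Z], UnifBddMeas (fun i (_ : Z) => a i) :=
    UnifBddMeas.const ha
  have h1 : UnifBddMeas fun i (w : X × X) => h i w.1 := hh.comp measurable_fst
  have h2 : UnifBddMeas fun i (w : X × X) => h i w.2 := hh.comp measurable_snd
  have hG : BddMeas fun w : X × X => ⨆ i, (a i + (h i w.2 - h i w.1)) :=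
    (ha'.add (h2.sub h1)).iSup
  have hG' : BddMeas fun w : X × X => ⨆ i, (a i + (h i w.1 - h i w.2)) :=
    (ha'.add (h1.sub h2)).iSup
  have hR : BddMeas fun x =>
      (1 / 2) * ((⨆ i, (a i + 2 * L * f i x)) + (⨆ i, (a i - 2 * L * f i x))) :=
    ((ha'.add (hf.const_mul _)).iSup.add (ha'.sub (hf.const_mul _)).iSup).const_mul _
  have hm : ∃ A, ∀ i, |∫ x', h i x' ∂μ| ≤ A := hh.exists_abs_integral_le μ
  have ghost : ∫ x, ⨆ i, (a i + (∫ x', h i x' ∂μ - h i x)) ∂μ ≤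
      ∫ w, ⨆ i, (a i + (h i w.2 - h i w.1)) ∂(μ.prod μ) := by
    rw [hG.integral_prod]
    refine BddMeas.integral_mono (ha'.add ((UnifBddMeas.const hm).sub hh)).iSup
      (hG.integral_right μ) μ fun x => ciSup_le fun i => ?_
    have e : a i + (∫ x', h i x' ∂μ - h i x) = ∫ x', (a i + (h i x' - h i x)) ∂μ := by
      rw [integral_add (integrable_const _)
        (((hh.bddMeas i).sub (BddMeas.const (h i x))).integrable μ),
        integral_sub ((hh.bddMeas i).integrable μ) (integrable_const _)]
      simp
    rw [e]
    refine BddMeas.integral_mono ((BddMeas.const _).add ((hh.bddMeas i).sub (BddMeas.const _)))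
      (hG.comp measurable_prodMk_left) μ fun x' => ?_
    exact le_ciSup ((ha'.add (h2.sub h1)).bddAbove (x, x')) i
  have swap : ∫ w, ⨆ i, (a i + (h i w.2 - h i w.1)) ∂(μ.prod μ) =
      ∫ w, ⨆ i, (a i + (h i w.1 - h i w.2)) ∂(μ.prod μ) := by
    rw [hG.integral_prod, hG'.integral_prod_symm]
  -- Exchanging the point with its independent copy leaves the integral unchanged; averaging both
  -- versions plays the role of the random sign.
  have e1 : ∫ w, ⨆ i, (a i + (h i w.2 - h i w.1)) ∂(μ.prod μ) =
      ∫ w : X × X, (1 / 2) * ((⨆ i, (a i + (h i w.2 - h i w.1))) +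
        ⨆ i, (a i + (h i w.1 - h i w.2))) ∂(μ.prod μ) := by
    rw [integral_const_mul, integral_add (hG.integrable _) (hG'.integrable _), ← swap]
    ring
  have e2 : ∫ w : X × X, ((1 / 2) *
        ((1 / 2) * ((⨆ i, (a i + 2 * L * f i w.2)) + (⨆ i, (a i - 2 * L * f i w.2)))) +
      (1 / 2) * ((1 / 2) * ((⨆ i, (a i + 2 * L * f i w.1)) + (⨆ i, (a i - 2 * L * f i w.1)))))
        ∂(μ.prod μ) =
      ∫ x, (1 / 2) * ((⨆ i, (a i + 2 * L * f i x)) + (⨆ i, (a i - 2 * L * f i x))) ∂μ := by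
    exact hR.integral_prod_mean μ
  refine ghost.trans ?_
  rw [e1, ← e2]
  refine BddMeas.integral_mono ((hG.add hG').const_mul _)
    (((hR.comp measurable_snd).const_mul _).add ((hR.comp measurable_fst).const_mul _)) _
    fun w => ?_
  have := iSup_add_iSup_contraction (L := L) ha (hf.exists_abs_le w.2) (hf.exists_abs_le w.1)
    (fun i j => hL i j w.2) (fun i j => hL i j w.1)
  linarith

/-- The mean of `v` at the two points `e₁ y` and `e₂ y`. -/
def midValue (e₁ e₂ : Y → X) (v : X → ℝ) (y : Y) : ℝ := (v (e₁ y) + v (e₂ y)) / 2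

lemma UnifBddMeas.midValue {h : ι → X → ℝ} (hh : UnifBddMeas h) {e₁ e₂ : Y → X}
    (he₁ : Measurable e₁) (he₂ : Measurable e₂) :
    UnifBddMeas (fun i y => midValue e₁ e₂ (h i) y) := by
  have := ((hh.comp he₁).add (hh.comp he₂)).const_mul (1 / 2)
  refine (congrArg UnifBddMeas ?_).mp this
  funext i y
  simp only [SDU.midValue]
  ring

/-- Symmetrization and contraction for pairs with two equal marginals. -/
lemma integral_iSup_midValue_le [Countable ι] [Nonempty ι] (q : Measure Y)
    [IsProbabilityMeasure q] (μ : Measure X) [IsProbabilityMeasure μ] {e₁ e₂ : Y → X}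
    (he₁ : Measurable e₁) (he₂ : Measurable e₂) (hq₁ : q.map e₁ = μ) (hq₂ : q.map e₂ = μ)
    {f h : ι → X → ℝ} (hf : UnifBddMeas f) (hh : UnifBddMeas h) {L : ℝ}
    (hL : ∀ i j x, |h i x - h j x| ≤ L * |f i x - f j x|) {a : ι → ℝ} (ha : ∃ A, ∀ i, |a i| ≤ A) :
    ∫ y, ⨆ i, (a i + (∫ x', h i x' ∂μ - midValue e₁ e₂ (h i) y)) ∂q ≤
      ∫ x, (1 / 2) * ((⨆ i, (a i + 2 * L * f i x)) + (⨆ i, (a i - 2 * L * f i x))) ∂μ := by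
  have hm := hh.exists_abs_integral_le μ
  have hU : UnifBddMeas fun i x => a i + (∫ x', h i x' ∂μ - h i x) :=
    (UnifBddMeas.const ha).add ((UnifBddMeas.const hm).sub hh)
  -- The supremum of an average is at most the average of the suprema, and each member of the pair
  -- has law `μ`. Dependence inside the pair thus never matters, at the price that a pair counts as
  -- one point in the complexity.
  refine le_trans ?_ (integral_iSup_sub_le μ hf hh hL ha)
  have hS := hU.iSup
  have e : ∫ x, ⨆ i, (a i + (∫ x', h i x' ∂μ - h i x)) ∂μ =
      ∫ y, (1 / 2) * ((⨆ i, (a i + (∫ x', h i x' ∂μ - h i (e₁ y)))) +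
        (⨆ i, (a i + (∫ x', h i x' ∂μ - h i (e₂ y))))) ∂q := by
    rw [integral_const_mul, integral_add ((hS.comp he₁).integrable q)
      ((hS.comp he₂).integrable q)]
    have i1 := integral_map (μ := q) he₁.aemeasurable (f := fun x =>
      ⨆ i, (a i + (∫ x', h i x' ∂μ - h i x))) hS.1.aestronglyMeasurable
    have i2 := integral_map (μ := q) he₂.aemeasurable (f := fun x =>
      ⨆ i, (a i + (∫ x', h i x' ∂μ - h i x))) hS.1.aestronglyMeasurable
    rw [hq₁] at i1
    rw [hq₂] at i2
    rw [← i1, ← i2]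
    ring
  rw [e]
  refine BddMeas.integral_mono
    ((UnifBddMeas.const ha).add ((UnifBddMeas.const hm).sub (hh.midValue he₁ he₂))).iSup
    (((hS.comp he₁).add (hS.comp he₂)).const_mul _) q fun y => ciSup_le fun i => ?_
  have h1 := le_ciSup (hU.bddAbove (e₁ y)) i
  have h2 := le_ciSup (hU.bddAbove (e₂ y)) i
  simp only [midValue]
  linarith

/-- Symmetrization and contraction for samples of pairs with two equal marginals. -/
lemma integral_iSup_sum_midValue_le [Countable ι] [Nonempty ι] (q : Measure Y)
    [IsProbabilityMeasure q] (μ : Measure X) [IsProbabilityMeasure μ] {e₁ e₂ : Y → X}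
    (he₁ : Measurable e₁) (he₂ : Measurable e₂) (hq₁ : q.map e₁ = μ) (hq₂ : q.map e₂ = μ)
    {f h : ι → X → ℝ} (hf : UnifBddMeas f) (hh : UnifBddMeas h) {L : ℝ}
    (hL : ∀ i j x, |h i x - h j x| ≤ L * |f i x - f j x|) (n : ℕ) :
    ∀ {a : ι → ℝ}, (∃ A, ∀ i, |a i| ≤ A) →
    ∫ z, ⨆ i, (a i + ∑ k, (∫ x', h i x' ∂μ - midValue e₁ e₂ (h i) (z k)))
        ∂(Measure.pi fun _ : Fin n => q) ≤
      ∫ x, signedSup a f (2 * L) x ∂(Measure.pi fun _ : Fin n => μ) := by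
  induction n with
  | zero =>
    intro a _
    rw [Measure.pi_of_empty, Measure.pi_of_empty, integral_dirac, integral_dirac]
    simp [signedSup]
  | succ n ih =>
    intro a ha
    have hm := hh.exists_abs_integral_le μ
    have hd : UnifBddMeas fun i y => ∫ x', h i x' ∂μ - midValue e₁ e₂ (h i) y :=
      (UnifBddMeas.const hm).sub (hh.midValue he₁ he₂)
    have hsum : UnifBddMeas fun i (z : Fin n → Y) =>
        a i + ∑ k, (∫ x', h i x' ∂μ - midValue e₁ e₂ (h i) (z k)) :=
      (UnifBddMeas.const ha).add (UnifBddMeas.sum _ fun k => hd.comp (measurable_pi_apply k))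
    have hfc : UnifBddMeas fun i x => 2 * L * f i x := hf.const_mul _
    have hG : BddMeas fun w : Y × (Fin n → Y) =>
        ⨆ i, ((a i + ∑ k, (∫ x', h i x' ∂μ - midValue e₁ e₂ (h i) (w.2 k)))
          + (∫ x', h i x' ∂μ - midValue e₁ e₂ (h i) w.1)) :=
      ((hsum.comp measurable_snd).add (hd.comp measurable_fst)).iSup
    have hP : BddMeas fun w : X × (Fin n → Y) =>
        ⨆ i, (a i + ∑ k, (∫ x', h i x' ∂μ - midValue e₁ e₂ (h i) (w.2 k)) + 2 * L * f i w.1) :=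
      ((hsum.comp measurable_snd).add (hfc.comp measurable_fst)).iSup
    have hN : BddMeas fun w : X × (Fin n → Y) =>
        ⨆ i, (a i + ∑ k, (∫ x', h i x' ∂μ - midValue e₁ e₂ (h i) (w.2 k)) - 2 * L * f i w.1) :=
      ((hsum.comp measurable_snd).sub (hfc.comp measurable_fst)).iSup
    have hH := (hP.add hN).const_mul (1 / 2)
    have hS := (hf.signedSup ha (2 * L) (n + 1)).comp (measurable_finCons (Y := X) (n := n))
    rw [integral_pi_succ, integral_pi_succ, hS.integral_prod]
    calc ∫ w : Y × (Fin n → Y), (⨆ i, (a i + ∑ k, (∫ x', h i x' ∂μ -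
            midValue e₁ e₂ (h i) ((Fin.cons w.1 w.2 : Fin (n + 1) → Y) k))))
            ∂(q.prod (Measure.pi fun _ : Fin n => q))
        = ∫ w : Y × (Fin n → Y),
            (⨆ i, ((a i + ∑ k, (∫ x', h i x' ∂μ - midValue e₁ e₂ (h i) (w.2 k)))
              + (∫ x', h i x' ∂μ - midValue e₁ e₂ (h i) w.1)))
            ∂(q.prod (Measure.pi fun _ : Fin n => q)) := by
          refine integral_congr_ae (ae_of_all _ fun w => ?_)
          simp only [Fin.sum_univ_succ, Fin.cons_zero, Fin.cons_succ]
          congr 1; funext i; ring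
      _ = ∫ z, ∫ y, (⨆ i, ((a i + ∑ k, (∫ x', h i x' ∂μ - midValue e₁ e₂ (h i) (z k)))
              + (∫ x', h i x' ∂μ - midValue e₁ e₂ (h i) y))) ∂q
            ∂(Measure.pi fun _ : Fin n => q) := hG.integral_prod_symm _ _
      -- For fixed remaining coordinates `z`, their sum is a bounded offset, so the one-coordinate
      -- bound applies.
      _ ≤ ∫ z, ∫ x, (1 / 2) *
            ((⨆ i, (a i + ∑ k, (∫ x', h i x' ∂μ - midValue e₁ e₂ (h i) (z k)) + 2 * L * f i x)) +
            (⨆ i, (a i + ∑ k, (∫ x', h i x' ∂μ - midValue e₁ e₂ (h i) (z k)) - 2 * L * f i x)))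
            ∂μ ∂(Measure.pi fun _ : Fin n => q) :=
          BddMeas.integral_mono (hG.integral_left q) (hH.integral_left μ) _ fun z =>
            integral_iSup_midValue_le q μ he₁ he₂ hq₁ hq₂ hf hh hL (hsum.exists_abs_le z)
      _ = ∫ x, ∫ z, (1 / 2) *
            ((⨆ i, (a i + ∑ k, (∫ x', h i x' ∂μ - midValue e₁ e₂ (h i) (z k)) + 2 * L * f i x)) +
            (⨆ i, (a i + ∑ k, (∫ x', h i x' ∂μ - midValue e₁ e₂ (h i) (z k)) - 2 * L * f i x)))
            ∂(Measure.pi fun _ : Fin n => q) ∂μ := by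
          rw [← hH.integral_prod, ← hH.integral_prod_symm]
      -- With `x` fixed, `a ± 2 L f(x)` are bounded offsets for the induction hypothesis; this is
      -- why the offset is quantified inside the induction.
      _ ≤ ∫ x, ∫ z, signedSup a f (2 * L) (Fin.cons x z : Fin (n + 1) → X)
            ∂(Measure.pi fun _ : Fin n => μ) ∂μ := by
          refine BddMeas.integral_mono (hH.integral_right _) (hS.integral_right _) μ fun x => ?_
          obtain ⟨A, hA⟩ := ha
          obtain ⟨B, hB⟩ := hfc.exists_abs_le x
          have hp : ∃ A, ∀ i, |a i + 2 * L * f i x| ≤ A :=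
            ⟨A + B, fun i => (abs_add_le _ _).trans (add_le_add (hA i) (hB i))⟩
          have hn : ∃ A, ∀ i, |a i - 2 * L * f i x| ≤ A :=
            ⟨A + B, fun i => (abs_sub _ _).trans (add_le_add (hA i) (hB i))⟩
          simp only [signedSup_cons]
          rw [integral_const_mul, integral_const_mul,
            integral_add ((hP.comp measurable_prodMk_left).integrable _)
              ((hN.comp measurable_prodMk_left).integrable _),
            integral_add ((hf.signedSup hp _ n).integrable _)
              ((hf.signedSup hn _ n).integrable _)]
          refine mul_le_mul_of_nonneg_left (add_le_add ?_ ?_) (by norm_num)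
          · refine le_trans (le_of_eq ?_) (ih hp)
            congr 1; funext z; congr 1; funext i; ring
          · refine le_trans (le_of_eq ?_) (ih hn)
            congr 1; funext z; congr 1; funext i; ring

end Symmetrization

/-! ### Uniform deviations over a function class -/

section Deviation

variable {X Y : Type*} [MeasurableSpace X] [MeasurableSpace Y]

lemma bddMeas_comp_lipschitz {φ : ℝ → ℝ} {L : NNReal} (hφ : LipschitzWith L φ) {f : X → ℝ}
    (hf : BddMeas f) : BddMeas (fun x => φ (f x)) := by
  obtain ⟨hm, B, hB⟩ := hf
  refine ⟨hφ.continuous.measurable.comp hm, |φ 0| + L * B, fun x => ?_⟩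
  have h := hφ.dist_le_mul (f x) 0
  rw [Real.dist_eq, Real.dist_eq, sub_zero] at h
  have h1 : |φ (f x)| ≤ |φ (f x) - φ 0| + |φ 0| := by
    simpa using abs_add_le (φ (f x) - φ 0) (φ 0)
  have h2 := mul_le_mul_of_nonneg_left (hB x) L.coe_nonneg
  linarith

lemma abs_intUnits (s : ℤˣ) : |((s : ℤ) : ℝ)| = 1 := by
  rcases Int.units_eq_one_or s with rfl | rfl <;> simp

omit [MeasurableSpace X] in
/-- The signed average `(1 / n) ∑ σₖ f (z k)` is bounded by the uniform bound of `f`. -/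
lemma abs_signed_mean_le {n : ℕ} (hn : 0 < n) {f : X → ℝ} {B : ℝ} (hf : ∀ x, |f x| ≤ B)
    (σ : Fin n → ℤˣ) (z : Fin n → X) :
    |(1 / (n : ℝ)) * ∑ k, (((σ k : ℤˣ) : ℤ) : ℝ) * f (z k)| ≤ B := by
  have hn' : (0 : ℝ) < n := by exact_mod_cast hn
  rw [abs_mul, abs_of_pos (by positivity : (0 : ℝ) < 1 / n), one_div, inv_mul_le_iff₀ hn']
  refine (Finset.abs_sum_le_sum_abs _ _).trans ?_
  refine (Finset.sum_le_card_nsmul _ _ B fun k _ => ?_).trans (by simp)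
  rw [abs_mul, abs_intUnits, one_mul]
  exact hf _

/-- The supremum dominates the value at one member, whose average over signs vanishes by the
symmetry `σ ↦ -σ`. -/
lemma rademacher_nonneg {F : Set (X → ℝ)} {B : ℝ} (hB : ∀ f ∈ F, ∀ x, |f x| ≤ B)
    {f : X → ℝ} (hf : f ∈ F) {n : ℕ} (hn : 0 < n) (μ : Measure X) : 0 ≤ rademacher F n μ := by
  refine integral_nonneg fun z => mul_nonneg (by positivity) ?_
  have hsum : ∑ σ : Fin n → ℤˣ, (1 / (n : ℝ)) * ∑ k, (((σ k : ℤˣ) : ℤ) : ℝ) * f (z k) = 0 := by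
    rw [← Finset.mul_sum]
    have h : ∑ σ : Fin n → ℤˣ, ∑ k, (((σ k : ℤˣ) : ℤ) : ℝ) * f (z k) =
        ∑ σ : Fin n → ℤˣ, ∑ k, ((((-σ) k : ℤˣ) : ℤ) : ℝ) * f (z k) :=
      (Equiv.sum_comp (Equiv.neg (Fin n → ℤˣ))
        fun σ : Fin n → ℤˣ => ∑ k, (((σ k : ℤˣ) : ℤ) : ℝ) * f (z k)).symm
    simp only [Pi.neg_apply, Units.val_neg, Int.cast_neg, neg_mul, Finset.sum_neg_distrib] at h
    rw [self_eq_neg.1 h, mul_zero]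
  rw [← hsum]
  refine Finset.sum_le_sum fun σ _ => ?_
  exact le_ciSup (f := fun h : F => (1 / (n : ℝ)) *
    ∑ k, (((σ k : ℤˣ) : ℤ) : ℝ) * (h : X → ℝ) (z k))
    (bddAbove_range_of_abs_le fun h => abs_signed_mean_le hn (hB h h.2) σ z) ⟨f, hf⟩

/-- The Rademacher complexity only depends on a pointwise dense subclass. -/
lemma rademacher_eq_of_dense {F F₀ : Set (X → ℝ)} {B : ℝ} (hB : ∀ f ∈ F, ∀ x, |f x| ≤ B)
    (hne : F.Nonempty) (hsub : F₀ ⊆ F)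
    (hd : ∀ f ∈ F, ∃ u : ℕ → X → ℝ, (∀ k, u k ∈ F₀) ∧
      ∀ x, Filter.Tendsto (fun k => u k x) Filter.atTop (nhds (f x)))
    {n : ℕ} (hn : 0 < n) (μ : Measure X) : rademacher F₀ n μ = rademacher F n μ := by
  have : Nonempty F := hne.to_subtype
  have : Nonempty F₀ := by
    obtain ⟨f, hf⟩ := hne
    obtain ⟨u, hu, -⟩ := hd f hf
    exact ⟨⟨u 0, hu 0⟩⟩
  unfold rademacher
  congr 1
  funext z
  congr 1
  refine Finset.sum_congr rfl fun σ _ => le_antisymm ?_ ?_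
  · refine ciSup_le fun h => ?_
    exact le_ciSup (f := fun h : F => (1 / (n : ℝ)) *
      ∑ k, (((σ k : ℤˣ) : ℤ) : ℝ) * (h : X → ℝ) (z k))
      (bddAbove_range_of_abs_le fun h => abs_signed_mean_le hn (hB h h.2) σ z) ⟨h, hsub h.2⟩
  · refine ciSup_le fun h => ?_
    obtain ⟨u, hu, hlim⟩ := hd h h.2
    refine le_of_tendsto' ((tendsto_finsetSum _ fun k _ =>
      (hlim (z k)).const_mul (((σ k : ℤˣ) : ℤ) : ℝ)).const_mul (1 / (n : ℝ))) fun j => ?_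
    exact le_ciSup (f := fun h : F₀ => (1 / (n : ℝ)) *
      ∑ k, (((σ k : ℤˣ) : ℤ) : ℝ) * (h : X → ℝ) (z k))
      (bddAbove_range_of_abs_le fun h => abs_signed_mean_le hn (hB h (hsub h.2)) σ z)
      ⟨u j, hu j⟩

lemma integral_signedSup_eq (F : Set (X → ℝ)) {n : ℕ} {c : ℝ} (hc : 0 ≤ c) (μ : Measure X) :
    ∫ z, signedSup (0 : F → ℝ) (fun f x => (f : X → ℝ) x) (c / n) z
      ∂(Measure.pi fun _ : Fin n => μ) = c * rademacher F n μ := by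
  unfold rademacher
  rw [← integral_const_mul]
  congr 1
  funext z
  unfold signedSup
  rw [mul_left_comm, Finset.mul_sum _ _ c]
  congr 1
  refine Finset.sum_congr rfl fun σ _ => ?_
  rw [Real.mul_iSup_of_nonneg hc]
  congr 1
  funext f
  simp only [Pi.zero_apply, zero_add]
  rw [← mul_assoc, Finset.mul_sum]
  refine Finset.sum_congr rfl fun k _ => ?_
  ring

/-- The amount by which the sample mean of `g` falls short of its expectation. -/
def shortfall (μ : Measure X) (e₁ e₂ : Y → X) {n : ℕ} (z : Fin n → Y) (g : X → ℝ) : ℝ :=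
  ∫ x, g x ∂μ - (1 / (n : ℝ)) * ∑ k, midValue e₁ e₂ g (z k)

omit [MeasurableSpace Y] in
lemma tendsto_shortfall (μ : Measure X) [IsProbabilityMeasure μ] (e₁ e₂ : Y → X) {n : ℕ}
    (z : Fin n → Y) {u : ℕ → X → ℝ} {g : X → ℝ} {B : ℝ} (hm : ∀ k, Measurable (u k))
    (hB : ∀ k x, |u k x| ≤ B)
    (hlim : ∀ x, Filter.Tendsto (fun k => u k x) Filter.atTop (nhds (g x))) :
    Filter.Tendsto (fun k => shortfall μ e₁ e₂ z (u k)) Filter.atTop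
      (nhds (shortfall μ e₁ e₂ z g)) := by
  refine Filter.Tendsto.sub ?_ ?_
  · exact tendsto_integral_of_dominated_convergence (fun _ => B)
      (fun k => (hm k).aestronglyMeasurable) (integrable_const B)
      (fun k => ae_of_all _ (hB k)) (ae_of_all _ hlim)
  · exact (tendsto_finsetSum _ fun k _ =>
      ((hlim (e₁ (z k))).add (hlim (e₂ (z k)))).div_const 2).const_mul _

omit [MeasurableSpace Y] in
lemma sum_integral_sub_midValue (μ : Measure X) [IsProbabilityMeasure μ] (e₁ e₂ : Y → X) {n : ℕ}
    (hn : 0 < n) (z : Fin n → Y) {g g' : X → ℝ} (hg : BddMeas g) (hg' : BddMeas g') :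
    ∑ k, (∫ x, (1 / (n : ℝ)) * (g x - g' x) ∂μ -
        midValue e₁ e₂ (fun x => (1 / (n : ℝ)) * (g x - g' x)) (z k)) =
      shortfall μ e₁ e₂ z g - shortfall μ e₁ e₂ z g' := by
  have hn' : (n : ℝ) ≠ 0 := by exact_mod_cast hn.ne'
  rw [integral_const_mul, integral_sub (hg.integrable μ) (hg'.integrable μ),
    Finset.sum_sub_distrib]
  have h : ∀ k, midValue e₁ e₂ (fun x => (1 / (n : ℝ)) * (g x - g' x)) (z k) =
      (1 / (n : ℝ)) * midValue e₁ e₂ g (z k) - (1 / (n : ℝ)) * midValue e₁ e₂ g' (z k) :=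
    fun k => by unfold midValue; ring
  simp only [h, Finset.sum_sub_distrib, ← Finset.mul_sum, Finset.sum_const, Finset.card_univ,
    Fintype.card_fin, nsmul_eq_mul]
  unfold shortfall
  field_simp
  ring

/-- With probability at least `1 - exp (-s)`, the shortfalls of all members of the class exceed that
of a fixed member by at most the symmetrization bound plus a sub-Gaussian deviation. -/
theorem exists_shortfall_event {F : Set (X → ℝ)} (hF : IsPointwiseMeasurable F) {Cb : ℝ}
    (hCb : ∀ f ∈ F, ∀ x, |f x| ≤ Cb) {fstar : X → ℝ} (hfs : fstar ∈ F)
    (q : Measure Y) [IsProbabilityMeasure q] (μ : Measure X) [IsProbabilityMeasure μ]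
    {e₁ e₂ : Y → X} (he₁ : Measurable e₁) (he₂ : Measurable e₂) (hq₁ : q.map e₁ = μ)
    (hq₂ : q.map e₂ = μ) {D : Y → Y → ℝ} {K : ℝ} (hK : 0 < K) (hq : LipSubgaussian q D K)
    (hD0 : ∀ y, D y y = 0)
    (hD : ∀ (v : X → ℝ) (W : ℝ), (∀ x x', v x - v x' ≤ W) →
      ∀ y y', midValue e₁ e₂ v y' - midValue e₁ e₂ v y ≤ W * D y y')
    {n : ℕ} (hn : 0 < n) {φ : ℝ → ℝ} {L : NNReal} (hφ : LipschitzWith L φ) {w : ℝ}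
    (hw : ∀ z z', |z| ≤ Cb → |z'| ≤ Cb → φ z - φ z' ≤ w) {s : ℝ} (hs : 0 ≤ s) :
    ∃ E : Set (Fin n → Y), MeasurableSet E ∧
      (Measure.pi fun _ : Fin n => q).real Eᶜ ≤ Real.exp (-s) ∧
      ∀ z ∈ E, ∀ f ∈ F, shortfall μ e₁ e₂ z (fun x => φ (f x))
          - shortfall μ e₁ e₂ z (fun x => φ (fstar x)) ≤
        2 * L * rademacher F n μ + 2 * w * √(2 * K * s / n) := by
  have hX : Nonempty X := μ.nonempty_of_neZero
  have hn' : (0 : ℝ) < n := by exact_mod_cast hn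
  have hw0 : 0 ≤ w := by
    obtain ⟨x⟩ := hX
    simpa using hw (fstar x) (fstar x) (hCb _ hfs x) (hCb _ hfs x)
  rcases hw0.eq_or_lt with rfl | hwpos
  -- With zero oscillation all compositions with `φ` coincide; Chernoff's bound needs a positive
  -- increment constant, so this case is separate.
  · refine ⟨Set.univ, MeasurableSet.univ, by simp [Real.exp_nonneg], fun z _ f hf => ?_⟩
    have he : (fun x => φ (f x)) = fun x => φ (fstar x) := funext fun x =>
      le_antisymm (by simpa using hw _ _ (hCb f hf x) (hCb _ hfs x))
        (by simpa using hw _ _ (hCb _ hfs x) (hCb f hf x))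
    rw [he, sub_self]
    have := rademacher_nonneg hCb hfs hn μ
    positivity
  obtain ⟨hFm, F₀, hsub, hcount, hdense⟩ := hF
  have : Countable F₀ := hcount.to_subtype
  have : Nonempty F₀ := by
    obtain ⟨u, hu, -⟩ := hdense fstar hfs
    exact ⟨⟨u 0, hu 0⟩⟩
  have hbm : ∀ f ∈ F, BddMeas fun x => φ (f x) := fun f hf =>
    bddMeas_comp_lipschitz hφ ⟨hFm f hf, Cb, hCb f hf⟩
  have hf : UnifBddMeas fun (f : F₀) x => (f : X → ℝ) x :=
    ⟨fun f => hFm f (hsub f.2), Cb, fun f => hCb f (hsub f.2)⟩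
  -- Centring at `fstar` doubles the oscillation to `2 w`. It leaves the Lipschitz estimate `hL`
  -- untouched, since the centring term cancels between two members.
  have hosc : ∀ f ∈ F, ∀ x x', (1 / (n : ℝ)) * (φ (f x) - φ (fstar x)) -
      (1 / (n : ℝ)) * (φ (f x') - φ (fstar x')) ≤ 2 * w / n := fun f hf x x' => by
    have h1 := hw _ _ (hCb f hf x) (hCb f hf x')
    have h2 := hw _ _ (hCb _ hfs x') (hCb _ hfs x)
    rw [← mul_sub, one_div, inv_mul_le_iff₀ hn', mul_div_cancel₀ _ hn'.ne']
    linarith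
  have hh : UnifBddMeas fun (f : F₀) x => (1 / (n : ℝ)) * (φ ((f : X → ℝ) x) - φ (fstar x)) := by
    refine ⟨fun f => (((hbm f (hsub f.2)).sub (hbm _ hfs)).const_mul _).1, w / n, fun f x => ?_⟩
    have h1 := hw _ _ (hCb f (hsub f.2) x) (hCb _ hfs x)
    have h2 := hw _ _ (hCb _ hfs x) (hCb f (hsub f.2) x)
    rw [abs_mul, abs_of_pos (by positivity : (0 : ℝ) < 1 / n), one_div, inv_mul_le_iff₀ hn',
      mul_div_cancel₀ _ hn'.ne', abs_le]
    constructor <;> linarith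
  have hL : ∀ (f g : F₀) x, |(1 / (n : ℝ)) * (φ ((f : X → ℝ) x) - φ (fstar x)) -
      (1 / (n : ℝ)) * (φ ((g : X → ℝ) x) - φ (fstar x))| ≤
      (L / n) * |(f : X → ℝ) x - (g : X → ℝ) x| := fun f g x => by
    have h := hφ.dist_le_mul ((f : X → ℝ) x) ((g : X → ℝ) x)
    rw [Real.dist_eq, Real.dist_eq] at h
    rw [← mul_sub, sub_sub_sub_cancel_right, abs_mul,
      abs_of_pos (by positivity : (0 : ℝ) < 1 / n), one_div, inv_mul_le_iff₀ hn']
    refine h.trans (le_of_eq ?_)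
    field_simp
  set G : (Fin n → Y) → ℝ := fun z => ⨆ f : F₀, ((0 : F₀ → ℝ) f +
    ∑ k, (∫ x, (1 / (n : ℝ)) * (φ ((f : X → ℝ) x) - φ (fstar x)) ∂μ -
      midValue e₁ e₂ (fun x => (1 / (n : ℝ)) * (φ ((f : X → ℝ) x) - φ (fstar x))) (z k))) with hG
  have hfam : UnifBddMeas fun (f : F₀) (z : Fin n → Y) => ((0 : F₀ → ℝ) f +
      ∑ k, (∫ x, (1 / (n : ℝ)) * (φ ((f : X → ℝ) x) - φ (fstar x)) ∂μ -
      midValue e₁ e₂ (fun x => (1 / (n : ℝ)) * (φ ((f : X → ℝ) x) - φ (fstar x))) (z k))) :=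
    (UnifBddMeas.const ⟨0, by simp⟩).add (UnifBddMeas.sum _ fun k =>
      ((UnifBddMeas.const (hh.exists_abs_integral_le μ)).sub (hh.midValue he₁ he₂)).comp
        (measurable_pi_apply k))
  have hGb : BddMeas G := hfam.iSup
  have hmean : ∫ z, G z ∂(Measure.pi fun _ : Fin n => q) ≤ 2 * L * rademacher F n μ := by
    refine (integral_iSup_sum_midValue_le q μ he₁ he₂ hq₁ hq₂ hf hh hL n ⟨0, by simp⟩).trans ?_
    rw [← mul_div_assoc, integral_signedSup_eq F₀ (by positivity) μ,
      rademacher_eq_of_dense hCb ⟨_, hfs⟩ hsub hdense hn μ]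
  have hinc : ∀ z z', G z - G z' ≤ 2 * w / n * ∑ k, D (z k) (z' k) := by
    intro z z'
    rw [sub_le_iff_le_add]
    refine ciSup_le fun f => ?_
    have h1 := le_ciSup (hfam.bddAbove z') f
    have h2 : ∑ k, (midValue e₁ e₂ (fun x => (1 / (n : ℝ)) * (φ ((f : X → ℝ) x) - φ (fstar x)))
        (z' k) - midValue e₁ e₂ (fun x => (1 / (n : ℝ)) * (φ ((f : X → ℝ) x) - φ (fstar x)))
        (z k)) ≤ ∑ k, 2 * w / n * D (z k) (z' k) :=
      Finset.sum_le_sum fun k _ => hD _ _ (hosc f (hsub f.2)) _ _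
    rw [← Finset.mul_sum, Finset.sum_sub_distrib] at h2
    rw [Finset.sum_sub_distrib] at h1 ⊢
    change _ ≤ G z' at h1
    linarith
  have htail := (hq.pi hD0 n).measureReal_ge_le (mul_pos hn' hK) hGb
    (by positivity : 0 < 2 * w / n) hinc hs
  -- One coordinate moves the supremum by `2 w / n`, and the proxies of the `n` coordinates add to
  -- `n K`.
  have hdev : 2 * w / n * √(2 * (n * K) * s) = 2 * w * √(2 * K * s / n) := by
    have e : 2 * (n * K) * s = (n : ℝ) ^ 2 * (2 * K * s / n) := by field_simp
    rw [e, Real.sqrt_mul (by positivity), Real.sqrt_sq hn'.le]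
    field_simp
  rw [hdev] at htail
  refine ⟨{z | ∫ z, G z ∂(Measure.pi fun _ : Fin n => q) + 2 * w * √(2 * K * s / n) ≤ G z}ᶜ,
    (measurableSet_le measurable_const hGb.1).compl, by rwa [compl_compl], fun z hz => ?_⟩
  have hz' : G z < ∫ z, G z ∂(Measure.pi fun _ : Fin n => q) + 2 * w * √(2 * K * s / n) := by
    simpa using hz
  have hF₀ : ∀ f ∈ F₀, shortfall μ e₁ e₂ z (fun x => φ (f x))
      - shortfall μ e₁ e₂ z (fun x => φ (fstar x)) ≤
        2 * L * rademacher F n μ + 2 * w * √(2 * K * s / n) := by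
    intro f hf₀
    rw [← sum_integral_sub_midValue μ e₁ e₂ hn z (hbm f (hsub hf₀)) (hbm _ hfs)]
    have h1 := le_ciSup (hfam.bddAbove z) ⟨f, hf₀⟩
    change (0 : F₀ → ℝ) ⟨f, hf₀⟩ + _ ≤ G z at h1
    rw [Pi.zero_apply, zero_add] at h1
    linarith
  intro f hfF
  obtain ⟨u, hu, hlim⟩ := hdense f hfF
  -- Dominated convergence needs one bound for the whole sequence: all values lie within `w` of a
  -- single value of `φ ∘ fstar`.
  have hfe : UnifBddMeas fun (f : F₀) x => φ ((f : X → ℝ) x) :=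
    ⟨fun f => (hbm f (hsub f.2)).1, |φ (fstar hX.some)| + w, fun f x => by
      have h1 := hw _ _ (hCb f (hsub f.2) x) (hCb _ hfs hX.some)
      have h2 := hw _ _ (hCb _ hfs hX.some) (hCb f (hsub f.2) x)
      have h3 := abs_le.1 (le_refl |φ (fstar hX.some)|)
      rw [abs_le]
      constructor <;> linarith⟩
  obtain ⟨hm, B, hB⟩ := hfe
  refine le_of_tendsto' ((tendsto_shortfall μ e₁ e₂ z (fun k => hm ⟨u k, hu k⟩)
    (fun k => hB ⟨u k, hu k⟩)
    (fun x => (hφ.continuous.tendsto _).comp (hlim x))).sub_const _) fun k => hF₀ _ (hu k)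

end Deviation

/-! ### Laws of pairs -/

section PairDist

variable {X : Type*}

/-- The normalized Hamming distance of two unordered pairs. -/
def pairDist (y y' : X × X) : ℝ :=
  min ((1 / 2) * (discreteDist y.1 y'.1 + discreteDist y.2 y'.2))
    ((1 / 2) * (discreteDist y.1 y'.2 + discreteDist y.2 y'.1))

lemma pairDist_self (y : X × X) : pairDist y y = 0 := by
  unfold pairDist
  simp only [discreteDist_self]
  refine (min_eq_left ?_).trans (by norm_num)
  have := discreteDist_nonneg y.1 y.2
  have := discreteDist_nonneg y.2 y.1
  linarith

lemma pairDist_swap (y : X × X) : pairDist y y.swap = 0 := by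
  unfold pairDist
  simp only [Prod.fst_swap, Prod.snd_swap, discreteDist_self]
  refine (min_eq_right ?_).trans (by norm_num)
  have := discreteDist_nonneg y.1 y.2
  have := discreteDist_nonneg y.2 y.1
  linarith

lemma midValue_sub_le_pairDist {v : X → ℝ} {W : ℝ} (hv : ∀ x x', v x - v x' ≤ W)
    (y y' : X × X) :
    midValue Prod.fst Prod.snd v y' - midValue Prod.fst Prod.snd v y ≤ W * pairDist y y' := by
  have hW : 0 ≤ W := by simpa using hv y.1 y.1
  have hv' : ∀ x x', v x' - v x ≤ W * discreteDist x x' := fun x x' => by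
    have := le_mul_discreteDist (v := fun x => -v x) (c := W)
      (fun a b => by linarith [hv b a]) x x'
    linarith
  unfold pairDist midValue
  rw [mul_min_of_nonneg _ _ hW]
  refine le_min ?_ ?_
  · linarith [hv' y.1 y'.1, hv' y.2 y'.2]
  · linarith [hv' y.1 y'.2, hv' y.2 y'.1]

lemma midValue_sub_le_discreteDist {Y : Type*} {e₁ e₂ : Y → X} {v : X → ℝ} {W : ℝ}
    (hv : ∀ x x', v x - v x' ≤ W) (y y' : Y) :
    midValue e₁ e₂ v y' - midValue e₁ e₂ v y ≤ W * discreteDist y y' := by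
  have := le_mul_discreteDist (v := fun y => -midValue e₁ e₂ v y) (c := W) (fun a b => by
    unfold midValue; linarith [hv (e₁ b) (e₁ a), hv (e₂ b) (e₂ a)]) y y'
  linarith

/-- Each independent coordinate moves the function by at most `c / 2`, and `(c / 2) ^ 2 * (1 / 4 + 1
/ 4) = c ^ 2 / 8`. The two factors may differ, as dissimilar pairs require. -/
lemma lipSubgaussian_pairDist [MeasurableSpace X] (p r : Measure X) [IsProbabilityMeasure p]
    [IsProbabilityMeasure r] : LipSubgaussian (p.prod r) pairDist (1 / 8) := by
  intro g hg c hc hD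
  have h := ((lipSubgaussian_discreteDist p).prod (lipSubgaussian_discreteDist r)
    discreteDist_self discreteDist_self) g hg (c / 2) (by positivity) fun y y' => by
      refine (hD y y').trans ((mul_le_mul_of_nonneg_left (min_le_left _ _) hc).trans
        (le_of_eq ?_))
      ring
  refine h.trans (le_of_eq ?_)
  ring_nf

/-- A pair and its swap are at distance zero; forcing this symmetry is the purpose of the minimum in
`pairDist`. -/
lemma apply_swap_of_pairDist {g : X × X → ℝ} {c : ℝ}
    (hD : ∀ y y', g y - g y' ≤ c * pairDist y y') (y : X × X) : g y.swap = g y := by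
  have h1 := hD y y.swap
  have h2 := hD y.swap y
  have h3 := pairDist_swap y.swap
  rw [pairDist_swap] at h1
  rw [Prod.swap_swap] at h3
  rw [h3] at h2
  linarith

end PairDist

/-! ### Pair laws as mixtures of products of the class parts -/

section Laws

variable {X : Type*} [MeasurableSpace X]

/-- The part of the marginal law of the examples that comes from the class `t`. -/
def classPart (P : Measure (X × ℤˣ)) (t : ℤˣ) : Measure X :=
  (P.restrict {w | w.2 = t}).map Prod.fst

lemma measurableSet_label (t : ℤˣ) : MeasurableSet {w : X × ℤˣ | w.2 = t} := by
  have h : MeasurableSet ({t} : Set ℤˣ) :=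
    ⟨{(t : ℤ)}, measurableSet_singleton _, by ext; simp [Units.ext_iff]⟩
  exact measurable_snd h

omit [MeasurableSpace X] in
lemma label_compl : {w : X × ℤˣ | w.2 = 1}ᶜ = {w | w.2 = -1} := by
  ext w
  rcases Int.units_eq_one_or w.2 with h | h <;> simp [h]

omit [MeasurableSpace X] in
lemma sameLabel_eq : sameLabel X =
    ({w : X × ℤˣ | w.2 = 1} ×ˢ {w : X × ℤˣ | w.2 = 1}) ∪
      ({w : X × ℤˣ | w.2 = -1} ×ˢ {w : X × ℤˣ | w.2 = -1}) := by
  ext w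
  rcases Int.units_eq_one_or w.1.2 with h | h <;> rcases Int.units_eq_one_or w.2.2 with h' | h' <;>
    simp [sameLabel, h, h']

omit [MeasurableSpace X] in
lemma sameLabel_compl_eq : (sameLabel X)ᶜ =
    ({w : X × ℤˣ | w.2 = 1} ×ˢ {w : X × ℤˣ | w.2 = -1}) ∪
      ({w : X × ℤˣ | w.2 = -1} ×ˢ {w : X × ℤˣ | w.2 = 1}) := by
  ext w
  rcases Int.units_eq_one_or w.1.2 with h | h <;> rcases Int.units_eq_one_or w.2.2 with h' | h' <;>
    simp [sameLabel, h, h']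

omit [MeasurableSpace X] in
lemma disjoint_label_prod (A B : Set (X × ℤˣ)) :
    Disjoint ({w : X × ℤˣ | w.2 = 1} ×ˢ A) ({w : X × ℤˣ | w.2 = -1} ×ˢ B) := by
  refine Set.disjoint_left.2 fun w h h' => ?_
  have h1 : w.1.2 = 1 := h.1
  have h2 : w.1.2 = -1 := h'.1
  rw [h1] at h2
  exact absurd h2 (by decide)

variable (P : Measure (X × ℤˣ)) [IsProbabilityMeasure P]

instance (t : ℤˣ) : IsFiniteMeasure (classPart P t) := by
  unfold classPart; infer_instance

omit [IsProbabilityMeasure P] in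
lemma classPart_real_univ (t : ℤˣ) : (classPart P t).real Set.univ = classPrior P t := by
  unfold classPart classPrior
  rw [map_measureReal_apply measurable_fst MeasurableSet.univ]
  simp

lemma map_restrict_label_prod (s t : ℤˣ) :
    ((P.prod P).restrict ({w : X × ℤˣ | w.2 = s} ×ˢ {w : X × ℤˣ | w.2 = t})).map
      (fun w => (w.1.1, w.2.1)) = (classPart P s).prod (classPart P t) := by
  rw [← Measure.prod_restrict]
  exact (Measure.map_prod_map _ _ measurable_fst measurable_fst).symm

lemma measurable_examples :
    Measurable (fun w : (X × ℤˣ) × (X × ℤˣ) => (w.1.1, w.2.1)) :=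
  (measurable_fst.comp measurable_fst).prodMk (measurable_fst.comp measurable_snd)

lemma simPair_eq : simPair P = ((P.prod P) (sameLabel X))⁻¹ •
    ((classPart P 1).prod (classPart P 1) + (classPart P (-1)).prod (classPart P (-1))) := by
  unfold simPair ProbabilityTheory.cond
  rw [Measure.map_smul, ← map_restrict_label_prod, ← map_restrict_label_prod,
    ← Measure.map_add _ _ measurable_examples, ← Measure.restrict_union (disjoint_label_prod _ _)
      ((measurableSet_label _).prod (measurableSet_label _)), ← sameLabel_eq]

lemma dissimPair_eq : dissimPair P = ((P.prod P) (sameLabel X)ᶜ)⁻¹ •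
    ((classPart P 1).prod (classPart P (-1)) + (classPart P (-1)).prod (classPart P 1)) := by
  unfold dissimPair ProbabilityTheory.cond
  rw [Measure.map_smul, ← map_restrict_label_prod, ← map_restrict_label_prod,
    ← Measure.map_add _ _ measurable_examples, ← Measure.restrict_union (disjoint_label_prod _ _)
      ((measurableSet_label _).prod (measurableSet_label _)), ← sameLabel_compl_eq]

lemma simPair_map_swap : (simPair P).map Prod.swap = simPair P := by
  rw [simPair_eq, Measure.map_smul, Measure.map_add _ _ measurable_swap, Measure.prod_swap,
    Measure.prod_swap]

lemma dissimPair_map_swap : (dissimPair P).map Prod.swap = dissimPair P := by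
  rw [dissimPair_eq, Measure.map_smul, Measure.map_add _ _ measurable_swap, Measure.prod_swap,
    Measure.prod_swap, add_comm]

lemma simPair_map_snd : (simPair P).map Prod.snd = simPoint P := by
  rw [← simPair_map_swap, Measure.map_map measurable_snd measurable_swap]
  rfl

lemma dissimPair_map_snd : (dissimPair P).map Prod.snd = dissimPoint P := by
  rw [← dissimPair_map_swap, Measure.map_map measurable_snd measurable_swap]
  rfl

lemma simPrior_eq : simPrior P = classPrior P 1 ^ 2 + classPrior P (-1) ^ 2 := by
  unfold simPrior classPrior
  rw [sameLabel_eq, measureReal_union (disjoint_label_prod _ _)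
    ((measurableSet_label _).prod (measurableSet_label _)), measureReal_prod_prod,
    measureReal_prod_prod, sq, sq]

lemma dissimPrior_eq : dissimPrior P = 2 * classPrior P 1 * classPrior P (-1) := by
  unfold dissimPrior classPrior
  rw [sameLabel_compl_eq, measureReal_union (disjoint_label_prod _ _)
    ((measurableSet_label _).prod (measurableSet_label _)), measureReal_prod_prod,
    measureReal_prod_prod]
  ring

lemma classPrior_add : classPrior P 1 + classPrior P (-1) = 1 := by
  unfold classPrior
  rw [← label_compl, measureReal_add_measureReal_compl (measurableSet_label 1), probReal_univ]

/-- Conditioning creates no new charged sets. This brings the pointwise laws within reach of the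
complexity hypothesis, which concerns only laws with a density. -/
lemma simPoint_absolutelyContinuous : simPoint P ≪ P.map Prod.fst := by
  unfold simPoint simPair
  rw [Measure.map_map measurable_fst measurable_examples]
  have h : (P.prod P).map (Prod.fst ∘ fun w : (X × ℤˣ) × (X × ℤˣ) => (w.1.1, w.2.1)) =
      P.map Prod.fst := by
    rw [show (Prod.fst ∘ fun w : (X × ℤˣ) × (X × ℤˣ) => (w.1.1, w.2.1)) = Prod.fst ∘ Prod.fst
      from rfl, ← Measure.map_map measurable_fst measurable_fst, Measure.map_fst_prod]
    simp
  rw [← h]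
  exact (cond_absolutelyContinuous).map (measurable_fst.comp measurable_examples)

lemma dissimPoint_absolutelyContinuous : dissimPoint P ≪ P.map Prod.fst := by
  unfold dissimPoint dissimPair
  rw [Measure.map_map measurable_fst measurable_examples]
  have h : (P.prod P).map (Prod.fst ∘ fun w : (X × ℤˣ) × (X × ℤˣ) => (w.1.1, w.2.1)) =
      P.map Prod.fst := by
    rw [show (Prod.fst ∘ fun w : (X × ℤˣ) × (X × ℤˣ) => (w.1.1, w.2.1)) = Prod.fst ∘ Prod.fst
      from rfl, ← Measure.map_map measurable_fst measurable_fst, Measure.map_fst_prod]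
    simp
  rw [← h]
  exact (cond_absolutelyContinuous).map (measurable_fst.comp measurable_examples)

lemma simPrior_pos (hpos : 0 < classPrior P 1) : 0 < simPrior P := by
  rw [simPrior_eq]; positivity

lemma dissimPrior_pos (hpos : 0 < classPrior P 1) (hneg : 0 < classPrior P (-1)) :
    0 < dissimPrior P := by
  rw [dissimPrior_eq]; positivity

lemma isProbabilityMeasure_simPair (h : 0 < simPrior P) : IsProbabilityMeasure (simPair P) := by
  have : (P.prod P) (sameLabel X) ≠ 0 := fun h0 => by simp [simPrior, measureReal_def, h0] at h
  have := cond_isProbabilityMeasure this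
  exact Measure.isProbabilityMeasure_map measurable_examples.aemeasurable

lemma isProbabilityMeasure_dissimPair (h : 0 < dissimPrior P) :
    IsProbabilityMeasure (dissimPair P) := by
  have : (P.prod P) (sameLabel X)ᶜ ≠ 0 := fun h0 => by
    simp [dissimPrior, measureReal_def, h0] at h
  have := cond_isProbabilityMeasure this
  exact Measure.isProbabilityMeasure_map measurable_examples.aemeasurable

lemma simPrior_mul_integral_simPair (h : 0 < simPrior P) {g : X × X → ℝ} (hg : BddMeas g) :
    simPrior P * ∫ y, g y ∂(simPair P) =
      ∫ y, g y ∂((classPart P 1).prod (classPart P 1)) +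
        ∫ y, g y ∂((classPart P (-1)).prod (classPart P (-1))) := by
  rw [simPair_eq, integral_smul_measure, integral_add_measure (hg.integrable _) (hg.integrable _),
    ENNReal.toReal_inv, smul_eq_mul]
  exact mul_inv_cancel_left₀ h.ne' _

lemma dissimPrior_mul_integral_dissimPair (h : 0 < dissimPrior P) {g : X × X → ℝ}
    (hg : BddMeas g) :
    dissimPrior P * ∫ y, g y ∂(dissimPair P) =
      ∫ y, g y ∂((classPart P 1).prod (classPart P (-1))) +
        ∫ y, g y ∂((classPart P (-1)).prod (classPart P 1)) := by
  rw [dissimPair_eq, integral_smul_measure,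
    integral_add_measure (hg.integrable _) (hg.integrable _), ENNReal.toReal_inv, smul_eq_mul]
  exact mul_inv_cancel_left₀ h.ne' _

lemma integral_classPart_prod_fst (s t : ℤˣ) (v : X → ℝ) :
    ∫ y, v y.1 ∂((classPart P s).prod (classPart P t)) =
      classPrior P t * ∫ x, v x ∂(classPart P s) := by
  rw [integral_fun_fst, classPart_real_univ, smul_eq_mul]

lemma simPrior_mul_integral_simPoint (h : 0 < simPrior P) {v : X → ℝ} (hv : BddMeas v) :
    simPrior P * ∫ x, v x ∂(simPoint P) = classPrior P 1 * ∫ x, v x ∂(classPart P 1) +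
      classPrior P (-1) * ∫ x, v x ∂(classPart P (-1)) := by
  unfold simPoint
  rw [integral_map measurable_fst.aemeasurable hv.1.aestronglyMeasurable,
    simPrior_mul_integral_simPair P h (hv.comp measurable_fst), integral_classPart_prod_fst,
    integral_classPart_prod_fst]

lemma dissimPrior_mul_integral_dissimPoint (h : 0 < dissimPrior P) {v : X → ℝ}
    (hv : BddMeas v) :
    dissimPrior P * ∫ x, v x ∂(dissimPoint P) =
      classPrior P (-1) * ∫ x, v x ∂(classPart P 1) +
      classPrior P 1 * ∫ x, v x ∂(classPart P (-1)) := by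
  unfold dissimPoint
  rw [integral_map measurable_fst.aemeasurable hv.1.aestronglyMeasurable,
    dissimPrior_mul_integral_dissimPair P h (hv.comp measurable_fst), integral_classPart_prod_fst,
    integral_classPart_prod_fst]

lemma integral_unlabeled {v : X → ℝ} (hv : BddMeas v) :
    ∫ x, v x ∂(unlabeled P) =
      ∫ x, v x ∂(classPart P 1) + ∫ x, v x ∂(classPart P (-1)) := by
  unfold unlabeled classPart
  rw [← integral_add_measure (hv.integrable _) (hv.integrable _),
    ← Measure.map_add _ _ measurable_fst, ← label_compl,
    Measure.restrict_add_restrict_compl (measurableSet_label 1)]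

lemma risk_eq {ℓ : ℝ → ℤˣ → ℝ} {f : X → ℝ} (hv : ∀ t, BddMeas fun x => ℓ (f x) t) :
    risk P ℓ f = ∫ x, ℓ (f x) 1 ∂(classPart P 1) + ∫ x, ℓ (f x) (-1) ∂(classPart P (-1)) := by
  have hon : ∀ t, Set.EqOn (fun w : X × ℤˣ => ℓ (f w.1) t) (fun w => ℓ (f w.1) w.2)
      {w | w.2 = t} := fun t w (hw : w.2 = t) => by simp only [hw]
  have hint : ∀ t, IntegrableOn (fun w : X × ℤˣ => ℓ (f w.1) w.2) {w | w.2 = t} P := fun t =>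
    (integrableOn_congr_fun (hon t) (measurableSet_label t)).1
      (((hv t).comp measurable_fst).integrable P).integrableOn
  have hset : ∀ t, ∫ w in {w : X × ℤˣ | w.2 = t}, ℓ (f w.1) w.2 ∂P =
      ∫ x, ℓ (f x) t ∂(classPart P t) := fun t => by
    unfold classPart
    rw [integral_map measurable_fst.aemeasurable (hv t).1.aestronglyMeasurable]
    exact (setIntegral_congr_fun (measurableSet_label t) (hon t)).symm
  rw [← hset, ← hset]
  unfold risk
  rw [← label_compl, ← setIntegral_univ, ← Set.union_compl_self {w : X × ℤˣ | w.2 = 1}]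
  refine setIntegral_union disjoint_compl_right (measurableSet_label 1).compl (hint 1) ?_
  rw [label_compl]
  exact hint (-1)

/-- Dominated functions are swap-invariant, so on them and on their exponentials the two halves of
the mixture integrate equally. The law may then be replaced by the product of the two
class-conditional laws, where the members are independent. -/
lemma lipSubgaussian_dissimPair (hpos : 0 < classPrior P 1) (hneg : 0 < classPrior P (-1)) :
    LipSubgaussian (dissimPair P) pairDist (1 / 8) := by
  have hD := dissimPrior_pos P hpos hneg
  set p : ℤˣ → Measure X := fun t => (ENNReal.ofReal (classPrior P t))⁻¹ • classPart P t with hp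
  have hprior : ∀ t, 0 < classPrior P t := fun t => by
    rcases Int.units_eq_one_or t with rfl | rfl <;> assumption
  have hprob : ∀ t, IsProbabilityMeasure (p t) := fun t => ⟨by
    have h : classPart P t Set.univ = ENNReal.ofReal (classPrior P t) := by
      rw [← classPart_real_univ, ofReal_measureReal]
    rw [hp]
    simp only [Measure.smul_apply, smul_eq_mul, h]
    exact ENNReal.inv_mul_cancel (by simpa using hprior t) ENNReal.ofReal_ne_top⟩
  have hpart : ∀ t, classPart P t = ENNReal.ofReal (classPrior P t) • p t := fun t => by
    rw [hp, smul_smul, ENNReal.mul_inv_cancel (by simpa using hprior t) ENNReal.ofReal_ne_top,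
      one_smul]
  have hint : ∀ g : X × X → ℝ, BddMeas g → (∀ y, g y.swap = g y) →
      ∫ y, g y ∂(dissimPair P) = ∫ y, g y ∂((p 1).prod (p (-1))) := by
    intro g hg hsw
    have h := dissimPrior_mul_integral_dissimPair P hD hg
    have h2 : ∫ y, g y ∂((classPart P (-1)).prod (classPart P 1)) =
        ∫ y, g y ∂((classPart P 1).prod (classPart P (-1))) := by
      rw [← Measure.prod_swap, integral_map measurable_swap.aemeasurable
        hg.1.aestronglyMeasurable]
      simp only [hsw]
    have h3 : ∫ y, g y ∂((classPart P 1).prod (classPart P (-1))) =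
        classPrior P 1 * (classPrior P (-1) * ∫ y, g y ∂((p 1).prod (p (-1)))) := by
      rw [hpart 1, hpart (-1), Measure.prod_smul_left, Measure.prod_smul_right,
        integral_smul_measure, integral_smul_measure, ENNReal.toReal_ofReal hpos.le,
        ENNReal.toReal_ofReal hneg.le, smul_eq_mul, smul_eq_mul]
    rw [h2, h3] at h
    refine mul_left_cancel₀ hD.ne' (h.trans ?_)
    rw [dissimPrior_eq]
    ring
  intro g hg c hc hL
  have hsw := apply_swap_of_pairDist hL
  rw [hint g hg hsw, hint _ hg.exp fun y => by rw [hsw]]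
  exact lipSubgaussian_pairDist (p 1) (p (-1)) g hg c hc hL

end Laws

/-! ### Losses -/

section Losses

variable {ℓ : ℝ → ℤˣ → ℝ} {ρ : NNReal}

lemma bddAbove_loss (hLip : ∀ t, LipschitzWith ρ (fun z => ℓ z t)) (b : ℝ) :
    BddAbove {c | ∃ (z : ℝ) (t : ℤˣ), |z| ≤ b ∧ c = ℓ z t} := by
  refine ⟨|ℓ 0 1| + |ℓ 0 (-1)| + ρ * b, ?_⟩
  rintro _ ⟨z, t, hz, rfl⟩
  have h := (hLip t).dist_le_mul z 0
  rw [Real.dist_eq, Real.dist_eq, sub_zero] at h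
  have h1 := mul_le_mul_of_nonneg_left hz ρ.coe_nonneg
  have h2 := le_abs_self (ℓ z t - ℓ 0 t)
  have h3 := le_abs_self (ℓ 0 t)
  have h4 := abs_nonneg (ℓ 0 1)
  have h5 := abs_nonneg (ℓ 0 (-1))
  rcases Int.units_eq_one_or t with rfl | rfl <;> linarith

lemma loss_le_maxLoss (hLip : ∀ t, LipschitzWith ρ (fun z => ℓ z t)) {b z : ℝ} (hz : |z| ≤ b)
    (t : ℤˣ) : ℓ z t ≤ maxLoss ℓ b :=
  le_csSup (bddAbove_loss hLip b) ⟨z, t, hz, rfl⟩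

/-- The combination `α ℓ(z, +1) + β ℓ(z, -1)` of the two losses. -/
def combLoss (ℓ : ℝ → ℤˣ → ℝ) (α β z : ℝ) : ℝ := α * ℓ z 1 + β * ℓ z (-1)

lemma lipschitzWith_combLoss (hLip : ∀ t, LipschitzWith ρ (fun z => ℓ z t)) {α β : ℝ}
    {A : NNReal} (hA : |α| + |β| ≤ A) : LipschitzWith (A * ρ) (combLoss ℓ α β) := by
  refine LipschitzWith.of_dist_le_mul fun z z' => ?_
  have h1 := (hLip 1).dist_le_mul z z'
  have h2 := (hLip (-1)).dist_le_mul z z'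
  rw [Real.dist_eq] at h1 h2 ⊢
  have e : combLoss ℓ α β z - combLoss ℓ α β z' =
      α * (ℓ z 1 - ℓ z' 1) + β * (ℓ z (-1) - ℓ z' (-1)) := by unfold combLoss; ring
  have h3 := mul_le_mul_of_nonneg_left h1 (abs_nonneg α)
  have h4 := mul_le_mul_of_nonneg_left h2 (abs_nonneg β)
  have h5 := mul_le_mul_of_nonneg_right hA (mul_nonneg ρ.coe_nonneg (dist_nonneg (x := z) (y := z')))
  rw [e, NNReal.coe_mul]
  refine (abs_add_le _ _).trans ?_
  rw [abs_mul, abs_mul]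
  linarith

lemma combLoss_sub_le (hℓ : ∀ z t, 0 ≤ ℓ z t) (hLip : ∀ t, LipschitzWith ρ (fun z => ℓ z t))
    {α β A b z z' : ℝ} (hA : |α| + |β| ≤ A) (hz : |z| ≤ b) (hz' : |z'| ≤ b) :
    combLoss ℓ α β z - combLoss ℓ α β z' ≤ A * maxLoss ℓ b := by
  have hd : ∀ t, |ℓ z t - ℓ z' t| ≤ maxLoss ℓ b := fun t => by
    have := hℓ z t
    have := hℓ z' t
    have := loss_le_maxLoss hLip hz t
    have := loss_le_maxLoss hLip hz' t
    rw [abs_le]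
    constructor <;> linarith
  have h0 : 0 ≤ maxLoss ℓ b := (abs_nonneg _).trans (hd 1)
  have e : combLoss ℓ α β z - combLoss ℓ α β z' =
      α * (ℓ z 1 - ℓ z' 1) + β * (ℓ z (-1) - ℓ z' (-1)) := by unfold combLoss; ring
  have h3 := mul_le_mul_of_nonneg_left (hd 1) (abs_nonneg α)
  have h4 := mul_le_mul_of_nonneg_left (hd (-1)) (abs_nonneg β)
  have h5 := mul_le_mul_of_nonneg_right hA h0
  have h6 := le_abs_self (α * (ℓ z 1 - ℓ z' 1))
  have h7 := le_abs_self (β * (ℓ z (-1) - ℓ z' (-1)))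
  rw [abs_mul] at h6 h7
  rw [e]
  linarith

end Losses

/-! ### Deviation of one sample -/

section Sample

variable {X Y : Type*} [MeasurableSpace X] [MeasurableSpace Y]

/-- Averages over the two points `e₁ y` and `e₂ y` of functions of oscillation `W` are sub-Gaussian
with variance proxy `W ^ 2 * K`, uniformly over functions with the same increments. -/
def MidValueConcentration (q : Measure Y) (e₁ e₂ : Y → X) (K : ℝ) : Prop :=
  ∃ D : Y → Y → ℝ, LipSubgaussian q D K ∧ (∀ y, D y y = 0) ∧
    ∀ (v : X → ℝ) (W : ℝ), (∀ x x', v x - v x' ≤ W) →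
      ∀ y y', midValue e₁ e₂ v y' - midValue e₁ e₂ v y ≤ W * D y y'

omit [MeasurableSpace X] in
lemma midValueConcentration_discrete (q : Measure Y) [IsProbabilityMeasure q] (e₁ e₂ : Y → X) :
    MidValueConcentration q e₁ e₂ (1 / 4) :=
  ⟨discreteDist, lipSubgaussian_discreteDist q, discreteDist_self,
    fun _ _ hv => midValue_sub_le_discreteDist hv⟩

lemma midValueConcentration_of_pairDist {q : Measure (X × X)} {K : ℝ}
    (hq : LipSubgaussian q pairDist K) : MidValueConcentration q Prod.fst Prod.snd K :=
  ⟨pairDist, hq, pairDist_self, fun _ _ hv => midValue_sub_le_pairDist hv⟩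

/-- Uniform deviation for a combination of losses, for a sample with `N` effective points. -/
lemma exists_combLoss_event {ℓ : ℝ → ℤˣ → ℝ} (hℓ : ∀ z t, 0 ≤ ℓ z t) {ρ : NNReal}
    (hLip : ∀ t, LipschitzWith ρ (fun z => ℓ z t)) {F : Set (X → ℝ)}
    (hF : IsPointwiseMeasurable F) {Cb : ℝ} (hCb : ∀ f ∈ F, ∀ x, |f x| ≤ Cb) {fstar : X → ℝ}
    (hfs : fstar ∈ F) (P : Measure (X × ℤˣ)) (q : Measure Y) [IsProbabilityMeasure q]
    (μ : Measure X) [IsProbabilityMeasure μ] {e₁ e₂ : Y → X} (he₁ : Measurable e₁)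
    (he₂ : Measurable e₂) (hq₁ : q.map e₁ = μ) (hq₂ : q.map e₂ = μ) {K N : ℝ} (hK : 0 < K)
    (hq : MidValueConcentration q e₁ e₂ K) {n : ℕ} (hn : 0 < n) (hN : 4 * K * N = n)
    (hN2 : N ≤ 2 * n) {CF : ℝ} (hCF : rademacher F n μ ≤ CF / √(n : ℝ)) {α β κ : ℝ} (hκ : 0 ≤ κ)
    (hαβ : |α| + |β| ≤ κ / |classPrior P 1 - classPrior P (-1)|) {δ : ℝ} (hδ : 0 < δ)
    (hδ1 : δ < 1) :
    ∃ E : Set (Fin n → Y), MeasurableSet E ∧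
      (Measure.pi fun _ : Fin n => q).real Eᶜ ≤ δ / 8 ∧
      ∀ z ∈ E, ∀ f ∈ F, shortfall μ e₁ e₂ z (fun x => combLoss ℓ α β (f x))
          - shortfall μ e₁ e₂ z (fun x => combLoss ℓ α β (fstar x)) ≤
        κ * boundConst P ρ CF (maxLoss ℓ Cb) δ / √N := by
  obtain ⟨D, hD, hD0, hDv⟩ := hq
  have hn' : (0 : ℝ) < n := by exact_mod_cast hn
  have hNpos : 0 < N := by
    by_contra h
    have := mul_nonpos_of_nonneg_of_nonpos (by positivity : 0 ≤ 4 * K) (not_lt.1 h)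
    linarith
  set d := |classPrior P 1 - classPrior P (-1)| with hd
  have hd0 : 0 ≤ d := abs_nonneg _
  have hA : 0 ≤ κ / d := by positivity
  set s := Real.log (8 / δ) with hs
  have hs0 : 0 ≤ s := Real.log_nonneg (by rw [le_div_iff₀ hδ]; linarith)
  have hexp : Real.exp (-s) = δ / 8 := by
    rw [Real.exp_neg, hs, Real.exp_log (by positivity), inv_div]
  obtain ⟨E, hE, hEp, hEf⟩ := exists_shortfall_event hF hCb hfs q μ he₁ he₂ hq₁ hq₂ hK hD hD0 hDv hn
    (lipschitzWith_combLoss hLip (A := Real.toNNReal (κ / d))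
      (hαβ.trans (Real.le_coe_toNNReal _)))
    (fun z z' hz hz' => combLoss_sub_le hℓ hLip hαβ hz hz') hs0
  refine ⟨E, hE, hexp ▸ hEp, fun z hz f hf => (hEf z hz f hf).trans ?_⟩
  have hX : Nonempty X := μ.nonempty_of_neZero
  set C := maxLoss ℓ Cb
  have hC0 : 0 ≤ C := (hℓ _ 1).trans (loss_le_maxLoss hLip (hCb _ hfs hX.some) 1)
  have hR0 := rademacher_nonneg hCb hfs hn μ
  have hsn : 0 < √(n : ℝ) := Real.sqrt_pos.2 hn'
  have hsN : 0 < √N := Real.sqrt_pos.2 hNpos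
  have hCF0 : 0 ≤ CF := by
    have := mul_nonneg (hR0.trans hCF) hsn.le
    rwa [div_mul_cancel₀ _ hsn.ne'] at this
  -- The complexity is known at `n` points, while the rate sought is `1 / √N`. A factor 2 can be
  -- lost: the one-sided bound carries only `2 ρ`, and the constant allows `4 ρ`.
  have hroot : √N ≤ 2 * √(n : ℝ) := by
    rw [show (2 : ℝ) * √(n : ℝ) = √(4 * n) by
      rw [Real.sqrt_mul (by norm_num), show (4 : ℝ) = 2 ^ 2 by norm_num,
        Real.sqrt_sq (by norm_num)]]
    exact Real.sqrt_le_sqrt (by linarith)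
  have h1 : rademacher F n μ ≤ 2 * CF / √N := by
    refine hCF.trans ?_
    rw [div_le_div_iff₀ hsn hsN]
    have := mul_le_mul_of_nonneg_left hroot hCF0
    linarith
  -- Substituting `n = 4 K N` turns `2 K s / n` into `s / (2 N)`.
  have h2 : 2 * C * √(2 * K * s / n) = √(2 * C ^ 2 * s) / √N := by
    rw [← Real.sqrt_div' _ hNpos.le, show 2 * C = √((2 * C) ^ 2) by
      rw [Real.sqrt_sq (by positivity)], ← Real.sqrt_mul (by positivity), ← hN]
    congr 1
    field_simp
    ring
  have h3 : 2 * ((κ / d) * ρ) * rademacher F n μ ≤ 2 * ((κ / d) * ρ) * (2 * CF / √N) :=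
    mul_le_mul_of_nonneg_left h1 (by positivity)
  calc 2 * ((Real.toNNReal (κ / d) * ρ : NNReal) : ℝ) * rademacher F n μ
        + 2 * (κ / d * C) * √(2 * K * s / n)
      = 2 * ((κ / d) * ρ) * rademacher F n μ + κ / d * (2 * C * √(2 * K * s / n)) := by
        rw [NNReal.coe_mul, Real.coe_toNNReal _ hA]; ring
    _ ≤ 2 * ((κ / d) * ρ) * (2 * CF / √N) + κ / d * (√(2 * C ^ 2 * s) / √N) := by
        rw [h2]; linarith
    _ = κ * boundConst P ρ CF C δ / √N := by
        unfold boundConst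
        rw [← hd, ← hs]
        ring

end Sample

/-! ### Risk decompositions -/

section Decomposition

variable {X : Type*} [MeasurableSpace X] {P : Measure (X × ℤˣ)} {ℓ : ℝ → ℤˣ → ℝ}

lemma integral_combLoss {f : X → ℝ} (hf : ∀ t, BddMeas fun x => ℓ (f x) t) (α β : ℝ)
    (μ : Measure X) [IsFiniteMeasure μ] :
    ∫ x, combLoss ℓ α β (f x) ∂μ = α * ∫ x, ℓ (f x) 1 ∂μ + β * ∫ x, ℓ (f x) (-1) ∂μ := by
  unfold combLoss
  rw [integral_add (((hf 1).const_mul α).integrable μ) (((hf (-1)).const_mul β).integrable μ),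
    integral_const_mul, integral_const_mul]

lemma bddMeas_combLoss {f : X → ℝ} (hf : ∀ t, BddMeas fun x => ℓ (f x) t) (α β : ℝ) :
    BddMeas fun x => combLoss ℓ α β (f x) :=
  ((hf 1).const_mul α).add ((hf (-1)).const_mul β)

lemma diffLoss_eq_combLoss (z : ℝ) : diffLoss P ℓ z =
    combLoss ℓ (1 / (classPrior P 1 - classPrior P (-1)))
      (-(1 / (classPrior P 1 - classPrior P (-1)))) z := by
  unfold diffLoss combLoss; ring

lemma neg_diffLoss_eq_combLoss (z : ℝ) : -diffLoss P ℓ z =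
    combLoss ℓ (-(1 / (classPrior P 1 - classPrior P (-1))))
      (1 / (classPrior P 1 - classPrior P (-1))) z := by
  unfold diffLoss combLoss; ring

lemma corrLoss_one_eq_combLoss (z : ℝ) : corrLoss P ℓ z 1 =
    combLoss ℓ (classPrior P 1 / (classPrior P 1 - classPrior P (-1)))
      (-(classPrior P (-1) / (classPrior P 1 - classPrior P (-1)))) z := by
  unfold corrLoss combLoss; ring

lemma corrLoss_neg_one_eq_combLoss (z : ℝ) : corrLoss P ℓ z (-1) =
    combLoss ℓ (-(classPrior P (-1) / (classPrior P 1 - classPrior P (-1))))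
      (classPrior P 1 / (classPrior P 1 - classPrior P (-1))) z := by
  unfold corrLoss combLoss
  rw [neg_neg]
  ring

variable [IsProbabilityMeasure P]

/-- Expanded over the class parts, the coefficients of `ℓ(·, -1)` on the positive part and of `ℓ(·,
1)` on the negative part cancel, and the two others equal `(π₊ - π₋) / (π₊ - π₋)`. -/
lemma risk_eq_SU (hne : classPrior P 1 ≠ classPrior P (-1)) (hS : 0 < simPrior P) {f : X → ℝ}
    (hf : ∀ t, BddMeas fun x => ℓ (f x) t) :
    risk P ℓ f = simPrior P * ∫ x, diffLoss P ℓ (f x) ∂(simPoint P) +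
      ∫ x, corrLoss P ℓ (f x) (-1) ∂(unlabeled P) := by
  have hd : classPrior P 1 - classPrior P (-1) ≠ 0 := sub_ne_zero.2 hne
  simp only [diffLoss_eq_combLoss, corrLoss_neg_one_eq_combLoss]
  rw [simPrior_mul_integral_simPoint P hS (bddMeas_combLoss hf _ _),
    integral_unlabeled P (bddMeas_combLoss hf _ _), risk_eq P hf]
  simp only [integral_combLoss hf]
  field_simp
  ring

lemma risk_eq_DU (hne : classPrior P 1 ≠ classPrior P (-1)) (hD : 0 < dissimPrior P) {f : X → ℝ}
    (hf : ∀ t, BddMeas fun x => ℓ (f x) t) :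
    risk P ℓ f = dissimPrior P * ∫ x, -diffLoss P ℓ (f x) ∂(dissimPoint P) +
      ∫ x, corrLoss P ℓ (f x) 1 ∂(unlabeled P) := by
  have hd : classPrior P 1 - classPrior P (-1) ≠ 0 := sub_ne_zero.2 hne
  simp only [neg_diffLoss_eq_combLoss, corrLoss_one_eq_combLoss]
  rw [dissimPrior_mul_integral_dissimPoint P hD (bddMeas_combLoss hf _ _),
    integral_unlabeled P (bddMeas_combLoss hf _ _), risk_eq P hf]
  simp only [integral_combLoss hf]
  field_simp
  ring

lemma risk_eq_SD (hne : classPrior P 1 ≠ classPrior P (-1)) (hS : 0 < simPrior P)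
    (hD : 0 < dissimPrior P) {f : X → ℝ} (hf : ∀ t, BddMeas fun x => ℓ (f x) t) :
    risk P ℓ f = simPrior P * ∫ x, corrLoss P ℓ (f x) 1 ∂(simPoint P) +
      dissimPrior P * ∫ x, corrLoss P ℓ (f x) (-1) ∂(dissimPoint P) := by
  have hd : classPrior P 1 - classPrior P (-1) ≠ 0 := sub_ne_zero.2 hne
  simp only [corrLoss_neg_one_eq_combLoss, corrLoss_one_eq_combLoss]
  rw [simPrior_mul_integral_simPoint P hS (bddMeas_combLoss hf _ _),
    dissimPrior_mul_integral_dissimPoint P hD (bddMeas_combLoss hf _ _), risk_eq P hf]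
  simp only [integral_combLoss hf]
  -- Unlike in the other two decompositions, the diagonal coefficient is `(π₊² - π₋²) / (π₊ - π₋) =
  -- π₊ + π₋`, so the total mass one is needed.
  have h1 : classPrior P 1 = 1 - classPrior P (-1) := by linarith [classPrior_add P]
  rw [h1] at hd ⊢
  field_simp
  ring

end Decomposition

/-! ### Excess risk bounds -/

section ExcessRisk

variable {X : Type*} [MeasurableSpace X]

omit [MeasurableSpace X] in
lemma pointMean_eq {n : ℕ} (u : Fin n → X) (g : X → ℝ) :
    pointMean u g = (1 / (n : ℝ)) * ∑ k, midValue id id g (u k) := by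
  simp [pointMean, midValue]

/-- The excess risk bounds for similar pairs with law `qS` and dissimilar pairs with law `qD` that
behave like `NS` and `ND` independent points. -/
theorem withProbAtLeast_excessRisk_le
    (P : Measure (X × ℤˣ)) [IsProbabilityMeasure P] (hpos : 0 < classPrior P 1)
    (hneg : 0 < classPrior P (-1)) (hne : classPrior P 1 ≠ classPrior P (-1))
    {ℓ : ℝ → ℤˣ → ℝ} (hℓ : ∀ z t, 0 ≤ ℓ z t) {ρ : NNReal}
    (hLip : ∀ t, LipschitzWith ρ (fun z => ℓ z t)) {F : Set (X → ℝ)}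
    (hF : IsPointwiseMeasurable F) {Cb : ℝ} (hCb : ∀ f ∈ F, ∀ x, |f x| ≤ Cb) {CF : ℝ}
    {fstar : X → ℝ} (hfs : fstar ∈ F)
    {nS nD nU : ℕ} (hnS : 0 < nS) (hnD : 0 < nD) (hnU : 0 < nU)
    (hCFS : rademacher F nS (simPoint P) ≤ CF / √(nS : ℝ))
    (hCFD : rademacher F nD (dissimPoint P) ≤ CF / √(nD : ℝ))
    (hCFU : rademacher F nU (unlabeled P) ≤ CF / √(nU : ℝ))
    {δ : ℝ} (hδ : 0 < δ)
    (qS qD : Measure (X × X)) [IsProbabilityMeasure qS] [IsProbabilityMeasure qD]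
    (hS₁ : qS.map Prod.fst = simPoint P) (hS₂ : qS.map Prod.snd = simPoint P)
    (hD₁ : qD.map Prod.fst = dissimPoint P) (hD₂ : qD.map Prod.snd = dissimPoint P)
    {KS KD NS ND : ℝ} (hKS : 0 < KS) (hKD : 0 < KD)
    (hqS : MidValueConcentration qS Prod.fst Prod.snd KS)
    (hqD : MidValueConcentration qD Prod.fst Prod.snd KD)
    (hNS : 4 * KS * NS = nS) (hNS2 : NS ≤ 2 * nS) (hND : 4 * KD * ND = nD) (hND2 : ND ≤ 2 * nD) :
    WithProbAtLeast (sampleLaw qS qD (unlabeled P) nS nD nU) δ fun D =>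
      (∀ f, IsMinimizer F (empRiskSU P ℓ D) f → risk P ℓ f - risk P ℓ fstar ≤
        boundConst P ρ CF (maxLoss ℓ Cb) δ * (2 * simPrior P / √NS + 1 / √(nU : ℝ))) ∧
      (∀ f, IsMinimizer F (empRiskDU P ℓ D) f → risk P ℓ f - risk P ℓ fstar ≤
        boundConst P ρ CF (maxLoss ℓ Cb) δ * (2 * dissimPrior P / √ND + 1 / √(nU : ℝ))) ∧
      (∀ f, IsMinimizer F (empRiskSD P ℓ D) f → risk P ℓ f - risk P ℓ fstar ≤
        boundConst P ρ CF (maxLoss ℓ Cb) δ * (simPrior P / √NS + dissimPrior P / √ND)) := by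
  rcases le_or_gt 1 δ with hδ1 | hδ1
  -- For `δ ≥ 1` the empty event will do.
  · exact ⟨∅, MeasurableSet.empty, by simpa using hδ1, by simp⟩
  have hπS := simPrior_pos P hpos
  have hπD := dissimPrior_pos P hpos hneg
  have : IsProbabilityMeasure (simPoint P) :=
    hS₁ ▸ Measure.isProbabilityMeasure_map measurable_fst.aemeasurable
  have : IsProbabilityMeasure (dissimPoint P) :=
    hD₁ ▸ Measure.isProbabilityMeasure_map measurable_fst.aemeasurable
  have : IsProbabilityMeasure (unlabeled P) :=
    Measure.isProbabilityMeasure_map measurable_fst.aemeasurable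
  have hbl : ∀ f ∈ F, ∀ t, BddMeas fun x => ℓ (f x) t := fun f hf t =>
    bddMeas_comp_lipschitz (hLip t) ⟨hF.1 f hf, Cb, hCb f hf⟩
  set Δ := classPrior P 1 - classPrior P (-1) with hΔ
  have hsum := classPrior_add P
  -- The corrected loss has total weight `1 / |Δ|` because the priors sum to one; the difference
  -- loss has `2 / |Δ|`, whence the factor 2 in the SU and DU bounds.
  have c1 : |classPrior P 1 / Δ| + |-(classPrior P (-1) / Δ)| ≤ 1 / |Δ| := by
    rw [abs_neg, abs_div, abs_div, ← add_div, abs_of_pos hpos, abs_of_pos hneg, hsum]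
  have c2 : |-(classPrior P (-1) / Δ)| + |classPrior P 1 / Δ| ≤ 1 / |Δ| := by
    rw [add_comm]; exact c1
  have c3 : |1 / Δ| + |-(1 / Δ)| ≤ 2 / |Δ| := by
    rw [abs_neg, abs_div, abs_one]; exact le_of_eq (by ring)
  have c4 : |-(1 / Δ)| + |1 / Δ| ≤ 2 / |Δ| := by
    rw [add_comm]; exact c3
  have evS := fun {α β κ : ℝ} => exists_combLoss_event (α := α) (β := β) (κ := κ) hℓ hLip hF hCb hfs
    P qS (simPoint P) measurable_fst measurable_snd hS₁ hS₂ hKS hqS hnS hNS hNS2 hCFS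
  have evD := fun {α β κ : ℝ} => exists_combLoss_event (α := α) (β := β) (κ := κ) hℓ hLip hF hCb hfs
    P qD (dissimPoint P) measurable_fst measurable_snd hD₁ hD₂ hKD hqD hnD hND hND2 hCFD
  -- A single point is treated as a pair with both members equal to it, so that `K = 1/4` and `N =
  -- nU`.
  have evU := fun {α β κ : ℝ} => exists_combLoss_event (α := α) (β := β) (κ := κ) (N := nU)
    hℓ hLip hF hCb hfs P (unlabeled P) (unlabeled P) measurable_id measurable_id Measure.map_id
    Measure.map_id (by norm_num) (midValueConcentration_discrete _ _ _) hnU (by ring)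
    (by linarith [(Nat.cast_nonneg nU : (0 : ℝ) ≤ nU)]) hCFU
  -- Each sample enters two of the three risks with two different losses, hence six events of
  -- failure probability at most `δ / 8`.
  obtain ⟨ES, hES, pES, bES⟩ := evS zero_le_two c3 hδ hδ1
  obtain ⟨ES', hES', pES', bES'⟩ := evS zero_le_one c1 hδ hδ1
  obtain ⟨ED, hED, pED, bED⟩ := evD zero_le_two c4 hδ hδ1
  obtain ⟨ED', hED', pED', bED'⟩ := evD zero_le_one c2 hδ hδ1
  obtain ⟨EU, hEU, pEU, bEU⟩ := evU zero_le_one c2 hδ hδ1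
  obtain ⟨EU', hEU', pEU', bEU'⟩ := evU zero_le_one c1 hδ hδ1
  have hprob : ∀ {Ω : Type _} [MeasurableSpace Ω] (Q : Measure Ω) [IsProbabilityMeasure Q]
      {A B : Set Ω}, MeasurableSet A → MeasurableSet B → Q.real Aᶜ ≤ δ / 8 → Q.real Bᶜ ≤ δ / 8 →
      1 - δ / 4 ≤ Q.real (A ∩ B) := by
    intro Ω _ Q _ A B hA hB h1 h2
    have h3 := probReal_add_probReal_compl (μ := Q) (hA.inter hB)
    have h4 := measureReal_union_le (μ := Q) Aᶜ Bᶜ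
    rw [← Set.compl_inter] at h4
    linarith
  refine ⟨(ES ∩ ES') ×ˢ ((ED ∩ ED') ×ˢ (EU ∩ EU')),
    (hES.inter hES').prod ((hED.inter hED').prod (hEU.inter hEU')), ?_, ?_⟩
  · unfold sampleLaw
    rw [measureReal_prod_prod, measureReal_prod_prod]
    have h1 := hprob _ hES hES' pES pES'
    have h2 := hprob _ hED hED' pED pED'
    have h3 := hprob _ hEU hEU' pEU pEU'
    have h0 : 0 ≤ 1 - δ / 4 := by linarith
    have h4 := mul_le_mul h1 (mul_le_mul h2 h3 h0 (h0.trans h2)) (mul_nonneg h0 h0) (h0.trans h1)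
    refine le_trans ?_ h4
    -- `(1 - δ/4)³ - (1 - δ) = δ/4 + δ² (3 - δ/4) / 16`.
    nlinarith [mul_nonneg (sq_nonneg δ) (by linarith : 0 ≤ 3 - δ / 4)]
  rintro D ⟨⟨hzS, hzS'⟩, ⟨hzD, hzD'⟩, hzU, hzU'⟩
  simp only [hΔ, ← diffLoss_eq_combLoss, ← neg_diffLoss_eq_combLoss, ← corrLoss_one_eq_combLoss,
    ← corrLoss_neg_one_eq_combLoss] at bES bES' bED bED' bEU bEU'
  set C := boundConst P ρ CF (maxLoss ℓ Cb) δ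
  refine ⟨fun f hf => ?_, fun f hf => ?_, fun f hf => ?_⟩
  -- The excess risk is the weighted sum of the shortfall differences plus an empirical excess, and
  -- the latter is nonpositive by `hmin`.
  · have hmin := hf.2 fstar hfs
    have h1 := mul_le_mul_of_nonneg_left (bES _ hzS f hf.1) hπS.le
    have h2 := bEU _ hzU f hf.1
    rw [risk_eq_SU hne hπS (hbl f hf.1), risk_eq_SU hne hπS (hbl _ hfs)]
    simp only [empRiskSU, pointMean_eq] at hmin
    simp only [pairMean, shortfall, midValue] at hmin h1 h2 ⊢
    have e : C * (2 * simPrior P / √NS + 1 / √(nU : ℝ)) =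
      simPrior P * (2 * C / √NS) + 1 * C / √(nU : ℝ) := by ring
    rw [e]
    linarith
  · have hmin := hf.2 fstar hfs
    have h1 := mul_le_mul_of_nonneg_left (bED _ hzD f hf.1) hπD.le
    have h2 := bEU' _ hzU' f hf.1
    rw [risk_eq_DU hne hπD (hbl f hf.1), risk_eq_DU hne hπD (hbl _ hfs)]
    simp only [empRiskDU, pointMean_eq] at hmin
    simp only [pairMean, shortfall, midValue] at hmin h1 h2 ⊢
    have e : C * (2 * dissimPrior P / √ND + 1 / √(nU : ℝ)) =
      dissimPrior P * (2 * C / √ND) + 1 * C / √(nU : ℝ) := by ring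
    rw [e]
    linarith
  · have hmin := hf.2 fstar hfs
    have h1 := mul_le_mul_of_nonneg_left (bES' _ hzS' f hf.1) hπS.le
    have h2 := mul_le_mul_of_nonneg_left (bED' _ hzD' f hf.1) hπD.le
    rw [risk_eq_SD hne hπS hπD (hbl f hf.1), risk_eq_SD hne hπS hπD (hbl _ hfs)]
    simp only [empRiskSD] at hmin
    simp only [pairMean, shortfall, midValue] at hmin h1 h2 ⊢
    have e : C * (simPrior P / √NS + dissimPrior P / √ND) =
      simPrior P * (1 * C / √NS) + dissimPrior P * (1 * C / √ND) := by ring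
    rw [e]
    linarith

end ExcessRisk

end SDU

end

/-! ### The theorem for both sampling schemes -/

theorem mainTheorem3 {X : Type*} [MeasurableSpace X]
    -- reference measure for densities, joint law of (example, label)
    (ν : MeasureTheory.Measure X) [MeasureTheory.SigmaFinite ν]
    (P : MeasureTheory.Measure (X × ℤˣ)) [MeasureTheory.IsProbabilityMeasure P]
    (hPν : P.map Prod.fst ≪ ν)
    (hpos : 0 < SDU.classPrior P 1) (hneg : 0 < SDU.classPrior P (-1))
    (hne : SDU.classPrior P 1 ≠ SDU.classPrior P (-1))
    -- loss function
    (ℓ : ℝ → ℤˣ → ℝ) (hℓ : ∀ z t, 0 ≤ ℓ z t)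
    (ρ : NNReal) (hρ : 0 < ρ) (hLip : ∀ t, LipschitzWith ρ (fun z => ℓ z t))
    -- model class
    (F : Set (X → ℝ)) (hF : SDU.IsPointwiseMeasurable F)
    (Cb : ℝ) (hCb : ∀ f ∈ F, ∀ x, |f x| ≤ Cb)
    (CF : ℝ)
    (hCF : ∀ n : ℕ, 0 < n → ∀ μ : MeasureTheory.Measure X,
      MeasureTheory.IsProbabilityMeasure μ → μ ≪ ν → SDU.rademacher F n μ ≤ CF / √(n : ℝ))
    (fstar : X → ℝ) (hstar : SDU.IsMinimizer F (SDU.risk P ℓ) fstar)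
    (nS nD nU : ℕ) (hnS : 0 < nS) (hnD : 0 < nD) (hnU : 0 < nU)
    (δ : ℝ) (hδ : 0 < δ) :
    -- the points of the similar and of the dissimilar pairs are i.i.d.
    (SDU.WithProbAtLeast (SDU.pointwiseLaw P nS nD nU) δ fun D =>
      (∀ f, SDU.IsMinimizer F (SDU.empRiskSU P ℓ D) f →
        SDU.risk P ℓ f - SDU.risk P ℓ fstar ≤
          SDU.boundConst P ρ CF (SDU.maxLoss ℓ Cb) δ *
            (2 * SDU.simPrior P / √(2 * (nS : ℝ)) + 1 / √(nU : ℝ))) ∧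
      (∀ f, SDU.IsMinimizer F (SDU.empRiskDU P ℓ D) f →
        SDU.risk P ℓ f - SDU.risk P ℓ fstar ≤
          SDU.boundConst P ρ CF (SDU.maxLoss ℓ Cb) δ *
            (2 * SDU.dissimPrior P / √(2 * (nD : ℝ)) + 1 / √(nU : ℝ))) ∧
      (∀ f, SDU.IsMinimizer F (SDU.empRiskSD P ℓ D) f →
        SDU.risk P ℓ f - SDU.risk P ℓ fstar ≤
          SDU.boundConst P ρ CF (SDU.maxLoss ℓ Cb) δ *
            (SDU.simPrior P / √(2 * (nS : ℝ)) + SDU.dissimPrior P / √(2 * (nD : ℝ))))) ∧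
    -- only the pairs are i.i.d., each pair with its own joint law
    (SDU.WithProbAtLeast (SDU.pairwiseLaw P nS nD nU) δ fun D =>
      (∀ f, SDU.IsMinimizer F (SDU.empRiskSU P ℓ D) f →
        SDU.risk P ℓ f - SDU.risk P ℓ fstar ≤
          SDU.boundConst P ρ CF (SDU.maxLoss ℓ Cb) δ *
            (2 * SDU.simPrior P / √(nS : ℝ) + 1 / √(nU : ℝ))) ∧
      (∀ f, SDU.IsMinimizer F (SDU.empRiskDU P ℓ D) f →
        SDU.risk P ℓ f - SDU.risk P ℓ fstar ≤
          SDU.boundConst P ρ CF (SDU.maxLoss ℓ Cb) δ *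
            (2 * SDU.dissimPrior P / √(2 * (nD : ℝ)) + 1 / √(nU : ℝ))) ∧
      (∀ f, SDU.IsMinimizer F (SDU.empRiskSD P ℓ D) f →
        SDU.risk P ℓ f - SDU.risk P ℓ fstar ≤
          SDU.boundConst P ρ CF (SDU.maxLoss ℓ Cb) δ *
            (SDU.simPrior P / √(nS : ℝ) + SDU.dissimPrior P / √(2 * (nD : ℝ))))) := by
  have hπS := SDU.simPrior_pos P hpos
  have hπD := SDU.dissimPrior_pos P hpos hneg
  have := SDU.isProbabilityMeasure_simPair P hπS
  have := SDU.isProbabilityMeasure_dissimPair P hπD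
  have hS : IsProbabilityMeasure (SDU.simPoint P) :=
    Measure.isProbabilityMeasure_map measurable_fst.aemeasurable
  have hD : IsProbabilityMeasure (SDU.dissimPoint P) :=
    Measure.isProbabilityMeasure_map measurable_fst.aemeasurable
  have hU : IsProbabilityMeasure (SDU.unlabeled P) :=
    Measure.isProbabilityMeasure_map measurable_fst.aemeasurable
  have key := SDU.withProbAtLeast_excessRisk_le P hpos hneg hne hℓ hLip hF hCb hstar.1 hnS hnD hnU
    (hCF nS hnS _ hS ((SDU.simPoint_absolutelyContinuous P).trans hPν))
    (hCF nD hnD _ hD ((SDU.dissimPoint_absolutelyContinuous P).trans hPν))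
    (hCF nU hnU _ hU hPν) hδ
  have hnS0 : (0 : ℝ) ≤ nS := Nat.cast_nonneg nS
  constructor
  -- Both pair laws are products, so `K = 1/8` and `N = 2n` for each.
  · exact key _ _ (by simp [Measure.map_fst_prod]) (by simp [Measure.map_snd_prod])
      (by simp [Measure.map_fst_prod]) (by simp [Measure.map_snd_prod]) (by norm_num) (by norm_num)
      (SDU.midValueConcentration_of_pairDist (SDU.lipSubgaussian_pairDist _ _))
      (SDU.midValueConcentration_of_pairDist (SDU.lipSubgaussian_pairDist _ _))
      (by ring) le_rfl (by ring) le_rfl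
  -- Similar pairs count once (`K = 1/4`, `N = nS`); dissimilar pairs keep `K = 1/8` and `N = 2 nD`.
  · exact key _ _ rfl (SDU.simPair_map_snd P) rfl (SDU.dissimPair_map_snd P) (by norm_num)
      (by norm_num) (SDU.midValueConcentration_discrete _ _ _)
      (SDU.midValueConcentration_of_pairDist (SDU.lipSubgaussian_dissimPair P hpos hneg))
      (by ring) (by linarith) (by ring) le_rfl
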